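/- Let $\Pi_n$ be the lattice of set partitions of $\{1,\dots,n\}$, ordered by refinement and ranked by $\mathrm{rank}(\pi)=n-\#\{\text{blocks of }\pi\}$. For a finite nonempty set $S$ of positive integers let $\Pi_n(S)$ be the subposet of partitions whose rank lies in $S$. Let $\alpha_S(n)$ be the complex permutation representation of the symmetric group $S_n$ on the maximal chains of $\Pi_n(S)$, and let $\beta_S(n)$ be the representation of $S_n$ on the top reduced homology $\tilde H_{|S|-1}(\Delta(\Pi_n(S));\mathbb C)$, where $\Delta(\Pi_n(S))$ is the order complex, whose simplices are the chains of $\Pi_n(S)$. Fix $S$ and an integer $k\ge 0$. For $n-k\ge k$ let $V_n(k)$ be the irreducible complex representation (Specht module) of $S_n$ indexed by the partition $(n-k,k)$. Then the multiplicity of $V_n(k)$ in $\alpha_S(n)$ and the multiplicity of $V_n(k)$ in $\beta_S(n)$ stabilise for $n\ge 2\max(S)+k$: there are nonnegative integers $a,b$, depending only on $S$ and $k$, such that for every $n$ with $n\ge 2\max(S)+k$ and $n-k\ge k$, the multiplicity of $V_n(k)$ in $\alpha_S(n)$ is $a$ and its multiplicity in $\beta_S(n)$ is $b$. -/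

import Mathlib

open scoped MonoidAlgebra

noncomputable section

namespace PartitionStability

/-- The multiplicity of the irreducible complex representation `σ` in the finite-dimensional complex
representation `ρ` of a finite group: the dimension of `Hom_G(σ, ρ)`. -/
def multiplicity {G V W : Type*} [Group G] [AddCommGroup V] [Module ℂ V] [AddCommGroup W]
    [Module ℂ W] (σ : Representation ℂ G V) (ρ : Representation ℂ G W) : ℕ :=
  Module.finrank ℂ (Representation.IntertwiningMap σ ρ)

/-! ### The partition lattice `Π_n` and its rank-selected subposets

`Π_n` is `Setoid (Fin n)`, whose order is refinement (the discrete partition is the least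
element). -/

/-- The rank of a set partition of an `n`-set: `n` minus its number of blocks. -/
def rank {n : ℕ} (p : Setoid (Fin n)) : ℕ := n - Nat.card (Quotient p)

/-- The rank-selected subposet `Π_n(S)`: all set partitions whose rank lies in `S`. -/
abbrev RankSelected (n : ℕ) (S : Finset ℕ) : Type := {p : Setoid (Fin n) // rank p ∈ S}

/-- The image of a set partition under a permutation: the blocks of `permute g p` are the sets
`g '' B` for `B` a block of `p`. -/
def permute {n : ℕ} (g : Equiv.Perm (Fin n)) (p : Setoid (Fin n)) : Setoid (Fin n) :=
  Setoid.comap (fun x => g⁻¹ x) p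

theorem permute_rel {n : ℕ} (g : Equiv.Perm (Fin n)) (p : Setoid (Fin n)) (x y : Fin n) :
    permute g p x y ↔ p (g⁻¹ x) (g⁻¹ y) := Iff.rfl

theorem permute_one {n : ℕ} (p : Setoid (Fin n)) : permute 1 p = p := by
  ext x y; simp [permute_rel]

theorem permute_mul {n : ℕ} (g h : Equiv.Perm (Fin n)) (p : Setoid (Fin n)) :
    permute (g * h) p = permute g (permute h p) := by
  ext x y; simp [permute_rel]

theorem rank_permute {n : ℕ} (g : Equiv.Perm (Fin n)) (p : Setoid (Fin n)) :
    rank (permute g p) = rank p := by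
  unfold rank
  congr 1
  exact Nat.card_congr (Quotient.congr g⁻¹ fun _ _ => Iff.rfl)

theorem permute_le_permute {n : ℕ} (g : Equiv.Perm (Fin n)) (p q : Setoid (Fin n)) :
    permute g p ≤ permute g q ↔ p ≤ q := by
  constructor
  · intro h x y hxy
    have := @h (g x) (g y) (by simpa [permute_rel] using hxy)
    simpa [permute_rel] using this
  · intro h x y hxy
    exact h hxy

/-- The action of the symmetric group `S_n` on `Π_n(S)` by order automorphisms. -/
def rankSelectedAction (n : ℕ) (S : Finset ℕ) :
    Equiv.Perm (Fin n) →* (RankSelected n S ≃o RankSelected n S) where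
  toFun g :=
    { toFun := fun p => ⟨permute g p.1, by rw [rank_permute]; exact p.2⟩
      invFun := fun p => ⟨permute g⁻¹ p.1, by rw [rank_permute]; exact p.2⟩
      left_inv := fun p => Subtype.ext (by
        change permute g⁻¹ (permute g p.1) = p.1
        rw [← permute_mul, inv_mul_cancel, permute_one])
      right_inv := fun p => Subtype.ext (by
        change permute g (permute g⁻¹ p.1) = p.1
        rw [← permute_mul, mul_inv_cancel, permute_one])
      map_rel_iff' := permute_le_permute g _ _ }
  map_one' := RelIso.ext fun p => Subtype.ext (permute_one p.1)
  map_mul' g h := RelIso.ext fun p => Subtype.ext (permute_mul g h p.1)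

/-- `α_S(n)`: the permutation representation of `S_n` on the maximal chains of `Π_n(S)`.
(A `Flag` is a maximal chain.) -/
def alpha (n : ℕ) (S : Finset ℕ) :
    Representation ℂ (Equiv.Perm (Fin n)) ℂ[Flag (RankSelected n S)] :=
  (Representation.ofMulAction ℂ (RankSelected n S ≃o RankSelected n S)
    (Flag (RankSelected n S))).comp (rankSelectedAction n S)

/-! ### Reduced simplicial homology of order complexes

A chain with `j` elements of a poset `P` is a strictly increasing sequence `Fin j ↪o P`; it is a
simplex of dimension `j - 1` of the order complex of `P`. The number `j` is used as the index, so
that `j = 0` (the empty simplex) gives the augmentation of the chain complex. -/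

section OrderComplex

variable (P : Type) [PartialOrder P]

instance chainAction (j : ℕ) : MulAction (P ≃o P) (Fin j ↪o P) where
  smul e c := c.trans e.toOrderEmbedding
  one_smul _ := rfl
  mul_smul _ _ _ := rfl

/-- The representation of the automorphism group of `P` on the `(j - 1)`-dimensional simplicial
chains of the order complex of `P`. -/
def chainRep (j : ℕ) : Representation ℂ (P ≃o P) ℂ[Fin j ↪o P] :=
  Representation.ofMulAction ℂ (P ≃o P) (Fin j ↪o P)

/-- The `l`-th face of a chain: its `l`-th element is removed. -/
def face {P : Type} [PartialOrder P] {j : ℕ} (l : Fin (j + 1)) (c : Fin (j + 1) ↪o P) :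
    Fin j ↪o P :=
  (Fin.succAboveOrderEmb l).trans c

/-- The simplicial boundary map
`(x₀ < ⋯ < x_j) ↦ ∑ l, (-1)^l (x₀ < ⋯ < x_{l-1} < x_{l+1} < ⋯ < x_j)`. -/
def boundary (j : ℕ) : ℂ[Fin (j + 1) ↪o P] →ₗ[ℂ] ℂ[Fin j ↪o P] :=
  Finsupp.linearCombination ℂ (fun c : Fin (j + 1) ↪o P =>
      ∑ l : Fin (j + 1), MonoidAlgebra.single (face l c) ((-1 : ℂ) ^ (l : ℕ))) ∘ₗ
    (MonoidAlgebra.coeffLinearEquiv ℂ).toLinearMap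

theorem boundary_single (j : ℕ) (c : Fin (j + 1) ↪o P) (a : ℂ) :
    boundary P j (MonoidAlgebra.single c a) =
      a • ∑ l : Fin (j + 1), MonoidAlgebra.single (face l c) ((-1 : ℂ) ^ (l : ℕ)) := by
  simp [boundary]

theorem boundary_chainRep (j : ℕ) (e : P ≃o P) (v : ℂ[Fin (j + 1) ↪o P]) :
    boundary P j (chainRep P (j + 1) e v) = chainRep P j e (boundary P j v) := by
  suffices h : boundary P j ∘ₗ chainRep P (j + 1) e = chainRep P j e ∘ₗ boundary P j from
    LinearMap.congr_fun h v
  ext c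
  simp only [LinearMap.comp_apply, MonoidAlgebra.lsingle_apply, chainRep,
    Representation.ofMulAction_single, boundary_single, one_smul, map_sum]
  rfl

/-- The simplicial cycles of dimension `j - 1`; every `(-1)`-dimensional chain is a cycle. -/
def cycles : (j : ℕ) → Submodule ℂ ℂ[Fin j ↪o P]
  | 0 => ⊤
  | j + 1 => LinearMap.ker (boundary P j)

/-- The simplicial boundaries of dimension `j - 1`, inside the cycles. -/
def boundaries (j : ℕ) : Submodule ℂ (cycles P j) :=
  (LinearMap.range (boundary P j)).comap (cycles P j).subtype

theorem cycles_le_comap (j : ℕ) (e : P ≃o P) :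
    cycles P j ≤ (cycles P j).comap (chainRep P j e) := by
  cases j with
  | zero => intro v _; trivial
  | succ j =>
    intro v hv
    have hv' : boundary P j v = 0 := hv
    change boundary P j (chainRep P (j + 1) e v) = 0
    rw [boundary_chainRep, hv', map_zero]

/-- The representation of the automorphism group of `P` on the cycles. -/
def cyclesRep (j : ℕ) : Representation ℂ (P ≃o P) (cycles P j) :=
  (chainRep P j).subrepresentation (cycles P j) (cycles_le_comap P j)

theorem boundaries_le_comap (j : ℕ) (e : P ≃o P) :
    boundaries P j ≤ (boundaries P j).comap (cyclesRep P j e) := by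
  rintro v ⟨w, hw⟩
  refine ⟨chainRep P (j + 1) e w, ?_⟩
  rw [boundary_chainRep, hw]
  rfl

/-- The reduced simplicial homology, with complex coefficients and in dimension `j - 1`, of the
order complex of `P`. -/
abbrev ReducedHomology (j : ℕ) : Type := cycles P j ⧸ boundaries P j

/-- The representation of the automorphism group of `P` on the reduced homology of the order
complex of `P` in dimension `j - 1`. -/
def homologyRep (j : ℕ) : Representation ℂ (P ≃o P) (ReducedHomology P j) :=
  (cyclesRep P j).quotient (boundaries P j) (boundaries_le_comap P j)

end OrderComplex

/-- `β_S(n)`: the representation of `S_n` on the reduced homology of (the order complex of) the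
rank-selected subposet `Π_n(S)`, in its top dimension `|S| - 1`. -/
def beta (n : ℕ) (S : Finset ℕ) :
    Representation ℂ (Equiv.Perm (Fin n)) (ReducedHomology (RankSelected n S) S.card) :=
  (homologyRep (RankSelected n S) S.card).comp (rankSelectedAction n S)

/-! ### Specht modules -/

/-- Tableaux of shape `μ` with entries `Fin n`, each used exactly once. -/
abbrev Tableau (μ : YoungDiagram) (n : ℕ) : Type := μ.cells ≃ Fin n

/-- The row of the tableau `t` that contains the entry `x`. -/
def rowOf {μ : YoungDiagram} {n : ℕ} (t : Tableau μ n) (x : Fin n) : ℕ := (t.symm x).1.1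

/-- The column of the tableau `t` that contains the entry `x`. -/
def colOf {μ : YoungDiagram} {n : ℕ} (t : Tableau μ n) (x : Fin n) : ℕ := (t.symm x).1.2

/-- Tabloids of shape `μ`: tableaux up to reordering the entries within the rows. A tabloid is
recorded as the function that sends an entry to its row. -/
abbrev Tabloid (μ : YoungDiagram) (n : ℕ) : Type := Set.range (rowOf (μ := μ) (n := n))

/-- The tabloid of a tableau. -/
def tabloid {μ : YoungDiagram} {n : ℕ} (t : Tableau μ n) : Tabloid μ n := ⟨rowOf t, t, rfl⟩

/-- The symmetric group acts on tabloids by permuting the entries. -/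
instance tabloidAction (μ : YoungDiagram) (n : ℕ) :
    MulAction (Equiv.Perm (Fin n)) (Tabloid μ n) where
  smul g r := ⟨fun x => r.1 (g⁻¹ x), by
    obtain ⟨_, t, rfl⟩ := r
    exact ⟨t.trans g, rfl⟩⟩
  one_smul _ := rfl
  mul_smul _ _ _ := rfl

theorem smul_tabloid {μ : YoungDiagram} {n : ℕ} (g : Equiv.Perm (Fin n)) (t : Tableau μ n) :
    g • tabloid t = tabloid (t.trans g) := rfl

open Classical in
/-- The column stabiliser of a tableau. -/
def colStabilizer {μ : YoungDiagram} {n : ℕ} (t : Tableau μ n) : Finset (Equiv.Perm (Fin n)) :=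
  Finset.univ.filter fun g => ∀ x, colOf t (g x) = colOf t x

/-- The polytabloid of a tableau: the signed sum of the translates of its tabloid under the column
stabiliser. -/
def polytabloid {μ : YoungDiagram} {n : ℕ} (t : Tableau μ n) : ℂ[Tabloid μ n] :=
  ∑ g ∈ colStabilizer t,
    MonoidAlgebra.single (g • tabloid t) (((Equiv.Perm.sign g : ℤˣ) : ℤ) : ℂ)

/-- The Specht module of shape `μ`: the span of the polytabloids in the permutation module on
tabloids. Over `ℂ` it is the irreducible representation of `S_n` indexed by `μ`, for a Young
diagram `μ` with `n` cells. -/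
def Specht (μ : YoungDiagram) (n : ℕ) : Submodule ℂ ℂ[Tabloid μ n] :=
  Submodule.span ℂ (Set.range (polytabloid (μ := μ) (n := n)))

theorem smul_polytabloid {μ : YoungDiagram} {n : ℕ} (g : Equiv.Perm (Fin n)) (t : Tableau μ n) :
    Representation.ofMulAction ℂ (Equiv.Perm (Fin n)) (Tabloid μ n) g (polytabloid t) =
      polytabloid (t.trans g) := by
  have hcol : ∀ x, colOf (t.trans g) x = colOf t (g⁻¹ x) := fun _ => rfl
  simp only [polytabloid, map_sum, Representation.ofMulAction_single]
  refine Finset.sum_bij' (fun c _ => g * c * g⁻¹) (fun c _ => g⁻¹ * c * g) ?_ ?_ ?_ ?_ ?_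
  · intro c hc
    simp only [colStabilizer, Finset.mem_filter, Finset.mem_univ, true_and] at hc ⊢
    intro x
    simp [hcol, hc]
  · intro c hc
    simp only [colStabilizer, Finset.mem_filter, Finset.mem_univ, true_and] at hc ⊢
    intro x
    have := hc (g x)
    simpa [hcol] using this
  · intro c _; group
  · intro c _; group
  · intro c _
    rw [← smul_tabloid, smul_smul, smul_smul, inv_mul_cancel_right]
    have hs : Equiv.Perm.sign (g * c * g⁻¹) = Equiv.Perm.sign c := by
      rw [map_mul, map_mul, map_inv, mul_right_comm, mul_inv_cancel, one_mul]
    rw [hs]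

theorem specht_le_comap (μ : YoungDiagram) (n : ℕ) (g : Equiv.Perm (Fin n)) :
    Specht μ n ≤ (Specht μ n).comap
      (Representation.ofMulAction ℂ (Equiv.Perm (Fin n)) (Tabloid μ n) g) := by
  refine Submodule.span_le.2 ?_
  rintro _ ⟨t, rfl⟩
  change _ ∈ Specht μ n
  rw [smul_polytabloid]
  exact Submodule.subset_span ⟨_, rfl⟩

/-- The representation of `S_n` on the Specht module of shape `μ`. -/
def spechtRep (μ : YoungDiagram) (n : ℕ) :
    Representation ℂ (Equiv.Perm (Fin n)) (Specht μ n) :=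
  (Representation.ofMulAction ℂ (Equiv.Perm (Fin n)) (Tabloid μ n)).subrepresentation
    (Specht μ n) (specht_le_comap μ n)

/-- The Young diagram of the partition `(a, b)`, where `a ≥ b ≥ 0`. -/
def twoRow (a b : ℕ) (h : b ≤ a) : YoungDiagram :=
  YoungDiagram.ofRowLens [a, b] (by simpa [List.sortedGE_iff_pairwise] using h)

end PartitionStability

end

/-! Let `M_k` be the permutation module of `S_n` on `k`-subsets. For `k ≤ n - k` one has `M_k =
V_n(k) ⊕ M_{k-1}`, so the multiplicity of `V_n(k)` in any representation is a difference of two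
multiplicities of permutation modules (`multiplicity_spechtRep`). The decomposition comes from the
raising and lowering operators of the Boolean lattice: raising is injective below the middle level,
lowering is its adjoint, and the kernel of lowering on level `k` is the Specht module. The last
point holds because a polytabloid of shape `(n-k, k)` is the squarefree polynomial `∏ (x_a - x_b)`
over the columns of length two, and such products span that kernel (`mem_span_pairFuns`).

Both `α_S(n)` and `β_S(n)` are kernels of equivariant maps of permutation modules. For `β` the map
is the simplicial boundary on chains with `|S|` elements, since no longer chains exist and homology
equals cycles. For `α` it is the zero map, since the maximal chains are exactly the chains with
`|S|` elements. For such a kernel inside `ℂ[Y]`, the intertwining maps from `ℂ[X]` are the invariant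
families `X → ℂ[Y]` in the kernel, and these correspond to the kernel of the induced map on orbits
of `X × Y` (`multiplicity_ofMulAction`).

It remains to compare the orbits of pairs (subset `A` with at most `k` elements, chain of
partitions) for `n` and `n + 1`. Adding a point outside `A` that is a singleton block of every
partition is injective on orbits and commutes with removing partitions from the chain. A partition
of rank `r` has at most `2r` points in non-singleton blocks, so once `n + 1 > 2 max(S) + k` every
pair on `n + 1` points has such a free point, and the map is bijective (`addPointOrbit_injective`,
`addPointOrbit_surjective`). Hence the kernel dimensions are constant from `n = 2 max(S) + k` on. -/

noncomputable section

namespace PartitionStability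

/-! ### Raising and lowering operators on the Boolean lattice. -/

section BooleanLattice

variable {ι : Type*} [DecidableEq ι]

/-- The lowering operator of the Boolean lattice of subsets of `s`. -/
def lower (s : Finset ι) : (Finset ι → ℂ) →ₗ[ℂ] (Finset ι → ℂ) where
  toFun f B := ∑ x ∈ s \ B, f (insert x B)
  map_add' f g := by ext B; simp [Finset.sum_add_distrib]
  map_smul' c f := by ext B; simp [Finset.mul_sum]

/-- The raising operator of the Boolean lattice of subsets of `s`. -/
def raise (s : Finset ι) : (Finset ι → ℂ) →ₗ[ℂ] (Finset ι → ℂ) where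
  toFun f A := ∑ x ∈ A ∩ s, f (A.erase x)
  map_add' f g := by ext B; simp [Finset.sum_add_distrib]
  map_smul' c f := by ext B; simp [Finset.mul_sum]

theorem lower_apply (s : Finset ι) (f : Finset ι → ℂ) (B : Finset ι) :
    lower s f B = ∑ x ∈ s \ B, f (insert x B) := rfl

theorem raise_apply (s : Finset ι) (f : Finset ι → ℂ) (A : Finset ι) :
    raise s f A = ∑ x ∈ A ∩ s, f (A.erase x) := rfl

/-- The `sl₂` commutation relation: exchanging one element of `B` for one outside contributes
equally to both products, so only the terms that add and remove the same element survive. -/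
theorem lower_raise_sub_raise_lower (s : Finset ι) (f : Finset ι → ℂ) (B : Finset ι) :
    lower s (raise s f) B - raise s (lower s f) B = ((s \ B).card - (B ∩ s).card : ℂ) * f B := by
  have h1 : lower s (raise s f) B =
      ∑ x ∈ s \ B, (f B + ∑ y ∈ B ∩ s, f (insert x (B.erase y))) := by
    refine Finset.sum_congr rfl fun x hx => ?_
    rw [Finset.mem_sdiff] at hx
    rw [raise_apply, Finset.insert_inter_of_mem hx.1,
      Finset.sum_insert (fun h => hx.2 (Finset.mem_inter.1 h).1), Finset.erase_insert hx.2]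
    congr 1
    refine Finset.sum_congr rfl fun y hy => ?_
    rw [Finset.erase_insert_of_ne]
    rintro rfl
    exact hx.2 (Finset.mem_inter.1 hy).1
  have h2 : raise s (lower s f) B =
      ∑ y ∈ B ∩ s, (f B + ∑ x ∈ s \ B, f (insert x (B.erase y))) := by
    refine Finset.sum_congr rfl fun y hy => ?_
    rw [Finset.mem_inter] at hy
    have : s \ B.erase y = insert y (s \ B) := by
      ext z
      simp only [Finset.mem_sdiff, Finset.mem_erase, Finset.mem_insert]
      by_cases hz : z = y
      · subst hz; simp [hy.2]
      · simp [hz]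
    rw [lower_apply, this, Finset.sum_insert (by simp [hy.1]), Finset.insert_erase hy.1]
  rw [h1, h2, Finset.sum_add_distrib, Finset.sum_add_distrib, Finset.sum_comm]
  simp only [Finset.sum_const, nsmul_eq_mul]
  ring

variable [Fintype ι]

/-- Adjointness: the pairs `(B, x)` with `x ∈ s \ B` match the pairs `(insert x B, x)`. -/
theorem sum_star_mul_lower (s : Finset ι) (f g : Finset ι → ℂ) :
    ∑ B, star (g B) * lower s f B = ∑ A, star (raise s g A) * f A := by
  simp only [lower_apply, raise_apply, star_sum, Finset.mul_sum, Finset.sum_mul]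
  rw [Finset.sum_sigma', Finset.sum_sigma']
  refine Finset.sum_bij' (fun p _ => ⟨insert p.2 p.1, p.2⟩) (fun p _ => ⟨p.1.erase p.2, p.2⟩)
    ?_ ?_ ?_ ?_ ?_
  · rintro ⟨B, x⟩ h
    simp only [Finset.mem_sigma, Finset.mem_univ, true_and, Finset.mem_sdiff] at h
    simp [h.1]
  · rintro ⟨A, x⟩ h
    simp only [Finset.mem_sigma, Finset.mem_univ, true_and, Finset.mem_inter] at h
    simp [h.2]
  · rintro ⟨B, x⟩ h
    simp only [Finset.mem_sigma, Finset.mem_univ, true_and, Finset.mem_sdiff] at h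
    simp [h.2]
  · rintro ⟨A, x⟩ h
    simp only [Finset.mem_sigma, Finset.mem_univ, true_and, Finset.mem_inter] at h
    simp [h.1]
  · rintro ⟨B, x⟩ h
    simp only [Finset.mem_sigma, Finset.mem_univ, true_and, Finset.mem_sdiff] at h
    simp [h.2]

theorem sum_star_mul_raise (s : Finset ι) (f g : Finset ι → ℂ) :
    ∑ A, star (f A) * raise s g A = ∑ B, star (lower s f B) * g B := by
  have := congrArg star (sum_star_mul_lower s f g)
  simp only [star_sum, star_mul', star_star] at this
  rw [Finset.sum_congr rfl fun A _ => mul_comm (star (f A)) (raise s g A), ← this]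
  exact Finset.sum_congr rfl fun _ _ => mul_comm _ _

theorem sum_star_mul_self {ι : Type*} [Fintype ι] (f : Finset ι → ℂ) :
    ∑ A, star (f A) * f A = ((∑ A, ‖f A‖ ^ 2 : ℝ) : ℂ) := by
  push_cast
  refine Finset.sum_congr rfl fun A _ => ?_
  rw [← Complex.conj_mul']
  rfl

theorem eq_zero_of_sum_norm_sq {ι : Type*} [Fintype ι] {f : Finset ι → ℂ}
    (h : ∑ A, ‖f A‖ ^ 2 = 0) : f = 0 := by
  ext A
  have := (Finset.sum_eq_zero_iff_of_nonneg fun A _ => by positivity).1 h A (Finset.mem_univ A)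
  simpa using this

/-- The commutation relation is paired with `f`, and adjointness turns the two products into norms.
The sign of `s.card - 2 * k` then decides which operator is injective on level `k`. -/
theorem norm_raise_sub_norm_lower (s : Finset ι) (k : ℕ) (f : Finset ι → ℂ)
    (hf : ∀ A, f A ≠ 0 → A ⊆ s ∧ A.card = k) :
    ∑ A, ‖raise s f A‖ ^ 2 - ∑ A, ‖lower s f A‖ ^ 2 =
      ((s.card : ℝ) - 2 * k) * ∑ A, ‖f A‖ ^ 2 := by
  have h1 := sum_star_mul_lower s (raise s f) f
  have h2 := sum_star_mul_raise s f (lower s f)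
  have h3 : ∑ B, star (f B) * (lower s (raise s f) B - raise s (lower s f) B) =
      ((s.card : ℂ) - 2 * k) * ∑ B, star (f B) * f B := by
    rw [Finset.mul_sum]
    refine Finset.sum_congr rfl fun B _ => ?_
    rw [lower_raise_sub_raise_lower]
    by_cases hB : f B = 0
    · simp [hB]
    · obtain ⟨hs, hk⟩ := hf B hB
      rw [Finset.inter_eq_left.2 hs, Finset.card_sdiff_of_subset hs, hk,
        Nat.cast_sub (hk ▸ Finset.card_le_card hs)]
      ring
  simp only [mul_sub, Finset.sum_sub_distrib] at h3
  rw [h1, h2, sum_star_mul_self, sum_star_mul_self, sum_star_mul_self] at h3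
  exact_mod_cast h3

theorem eq_zero_of_lower_eq_zero (s : Finset ι) (k : ℕ) (hk : s.card < 2 * k) (f : Finset ι → ℂ)
    (hf : ∀ A, f A ≠ 0 → A ⊆ s ∧ A.card = k) (h : lower s f = 0) : f = 0 := by
  have h1 := norm_raise_sub_norm_lower s k f hf
  rw [h] at h1
  apply eq_zero_of_sum_norm_sq
  have h2 : 0 ≤ ∑ A, ‖raise s f A‖ ^ 2 := Finset.sum_nonneg fun _ _ => by positivity
  have h3 : 0 ≤ ∑ A, ‖f A‖ ^ 2 := Finset.sum_nonneg fun _ _ => by positivity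
  have h4 : (s.card : ℝ) - 2 * k < 0 := by
    have : (s.card : ℝ) < 2 * k := by exact_mod_cast hk
    linarith
  simp only [Pi.zero_apply, norm_zero, ne_eq, OfNat.ofNat_ne_zero, not_false_eq_true, zero_pow,
    Finset.sum_const_zero, sub_zero] at h1
  nlinarith

theorem eq_zero_of_raise_eq_zero (s : Finset ι) (k : ℕ) (hk : 2 * k < s.card) (f : Finset ι → ℂ)
    (hf : ∀ A, f A ≠ 0 → A ⊆ s ∧ A.card = k) (h : raise s f = 0) : f = 0 := by
  have h1 := norm_raise_sub_norm_lower s k f hf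
  rw [h] at h1
  apply eq_zero_of_sum_norm_sq
  have h2 : 0 ≤ ∑ A, ‖lower s f A‖ ^ 2 := Finset.sum_nonneg fun _ _ => by positivity
  have h3 : 0 ≤ ∑ A, ‖f A‖ ^ 2 := Finset.sum_nonneg fun _ _ => by positivity
  have h4 : 0 < (s.card : ℝ) - 2 * k := by
    have : 2 * (k : ℝ) < s.card := by exact_mod_cast hk
    linarith
  simp only [Pi.zero_apply, norm_zero, ne_eq, OfNat.ofNat_ne_zero, not_false_eq_true, zero_pow,
    Finset.sum_const_zero, zero_sub] at h1
  nlinarith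

/-- By adjointness, the pairing of `f` with `lower s (raise s f)` is the squared norm of `raise s
f`. -/
theorem raise_eq_zero_of_lower_raise_eq_zero (s : Finset ι) (f : Finset ι → ℂ)
    (h : lower s (raise s f) = 0) : raise s f = 0 := by
  have h1 := sum_star_mul_lower s (raise s f) f
  rw [h, sum_star_mul_self] at h1
  apply eq_zero_of_sum_norm_sq
  have h2 : ((∑ A, ‖raise s f A‖ ^ 2 : ℝ) : ℂ) = 0 := by rw [← h1]; simp
  exact_mod_cast h2

end BooleanLattice

/-! ### Products of differences of variables span the kernel of the lowering operator. -/

section PairFun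

variable {ι : Type*}

/-- The list of the elements that occur in a list of pairs. -/
def pairElems (L : List (ι × ι)) : List ι := L.flatMap fun p => [p.1, p.2]

@[simp] theorem pairElems_nil : pairElems ([] : List (ι × ι)) = [] := rfl

@[simp] theorem pairElems_cons (p : ι × ι) (L : List (ι × ι)) :
    pairElems (p :: L) = p.1 :: p.2 :: pairElems L := rfl

theorem mem_pairElems {L : List (ι × ι)} {x : ι} :
    x ∈ pairElems L ↔ ∃ p ∈ L, x = p.1 ∨ x = p.2 := by
  simp [pairElems]

theorem length_pairElems (L : List (ι × ι)) : (pairElems L).length = 2 * L.length := by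
  induction L with
  | nil => rfl
  | cons p L ih => simp [ih]; ring

theorem nodup_pairElems_cons {p : ι × ι} {L : List (ι × ι)} :
    (pairElems (p :: L)).Nodup ↔
      p.1 ≠ p.2 ∧ p.1 ∉ pairElems L ∧ p.2 ∉ pairElems L ∧ (pairElems L).Nodup := by
  simp only [pairElems_cons, List.nodup_cons, List.mem_cons, not_or]
  tauto

variable [DecidableEq ι]

/-- The coefficients of the squarefree polynomial `∏ (x_a - x_b)`, where `(a, b)` runs over a list
of pairs. -/
def pairFun : List (ι × ι) → Finset ι → ℂ
  | [], A => if A = ∅ then 1 else 0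
  | p :: L, A => (if p.1 ∈ A then pairFun L (A.erase p.1) else 0) -
      (if p.2 ∈ A then pairFun L (A.erase p.2) else 0)

theorem mem_pairElems_of_pairFun_ne_zero {L : List (ι × ι)} {A : Finset ι} (h : pairFun L A ≠ 0)
    {x : ι} (hx : x ∈ A) : x ∈ pairElems L := by
  induction L generalizing A with
  | nil =>
    have : A = ∅ := by simpa [pairFun] using h
    simp [this] at hx
  | cons p L ih =>
    by_contra hne
    simp only [pairElems_cons, List.mem_cons, not_or] at hne
    have key : ∀ y, x ≠ y → pairFun L (A.erase y) = 0 := fun y hy => by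
      by_contra h0
      exact hne.2.2 (ih h0 (Finset.mem_erase.2 ⟨hy, hx⟩))
    simp [pairFun, key _ hne.1, key _ hne.2.1] at h

theorem card_of_pairFun_ne_zero {L : List (ι × ι)} {A : Finset ι} (h : pairFun L A ≠ 0) :
    A.card = L.length := by
  induction L generalizing A with
  | nil =>
    have : A = ∅ := by simpa [pairFun] using h
    simp [this]
  | cons p L ih =>
    by_contra hne
    have key : ∀ y, y ∈ A → pairFun L (A.erase y) = 0 := fun y hy => by
      by_contra h0
      have := ih h0
      rw [Finset.card_erase_of_mem hy] at this
      have := Finset.card_pos.2 ⟨y, hy⟩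
      simp at hne
      omega
    apply h
    rw [pairFun]
    split_ifs with h1 h2 h2 <;> simp [*]

/-- A monomial of `∏ (x_a - x_b)` takes exactly one variable from each factor, because the pairs are
disjoint. -/
theorem xor_of_pairFun_ne_zero {L : List (ι × ι)} (hL : (pairElems L).Nodup) {A : Finset ι}
    (h : pairFun L A ≠ 0) {p : ι × ι} (hp : p ∈ L) : Xor (p.1 ∈ A) (p.2 ∈ A) := by
  induction L generalizing A with
  | nil => simp at hp
  | cons q L ih =>
    rw [nodup_pairElems_cons] at hL
    obtain ⟨h1, h2, h3, h4⟩ := hL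
    have key : ∀ y z, y ∈ A → y ≠ z → y ∉ pairElems L → z ∉ pairElems L →
        pairFun L (A.erase y) ≠ 0 → z ∉ A ∧ (p ∈ L → Xor (p.1 ∈ A) (p.2 ∈ A)) := by
      intro y z hy hyz hyL hzL h0
      refine ⟨fun hz => hzL (mem_pairElems_of_pairFun_ne_zero h0
        (Finset.mem_erase.2 ⟨hyz.symm, hz⟩)), fun hpL => ?_⟩
      have := ih h4 h0 hpL
      have e1 : p.1 ≠ y := by
        rintro rfl; exact hyL (mem_pairElems.2 ⟨p, hpL, Or.inl rfl⟩)
      have e2 : p.2 ≠ y := by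
        rintro rfl; exact hyL (mem_pairElems.2 ⟨p, hpL, Or.inr rfl⟩)
      simpa [Finset.mem_erase, e1, e2] using this
    have : (q.1 ∈ A ∧ pairFun L (A.erase q.1) ≠ 0) ∨ (q.2 ∈ A ∧ pairFun L (A.erase q.2) ≠ 0) := by
      by_contra hne
      push Not at hne
      apply h
      rw [pairFun]
      split_ifs with h1 h2 h2 <;> simp [*]
    rcases this with ⟨hy, h0⟩ | ⟨hy, h0⟩
    · obtain ⟨k1, k2⟩ := key _ _ hy h1 h2 h3 h0
      rcases List.mem_cons.1 hp with rfl | hp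
      · exact Or.inl ⟨hy, k1⟩
      · exact k2 hp
    · obtain ⟨k1, k2⟩ := key _ _ hy h1.symm h3 h2 h0
      rcases List.mem_cons.1 hp with rfl | hp
      · exact Or.inr ⟨hy, k1⟩
      · exact k2 hp

theorem pairFun_firsts {L : List (ι × ι)} (hL : (pairElems L).Nodup) :
    pairFun L (L.map Prod.fst).toFinset = 1 := by
  induction L with
  | nil => simp [pairFun]
  | cons p L ih =>
    rw [nodup_pairElems_cons] at hL
    obtain ⟨h1, h2, h3, h4⟩ := hL
    have key : ∀ z, z ∉ pairElems L → z ∉ (L.map Prod.fst).toFinset := by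
      intro z hz hz'
      simp only [List.mem_toFinset, List.mem_map] at hz'
      obtain ⟨q, hq, rfl⟩ := hz'
      exact hz (mem_pairElems.2 ⟨q, hq, Or.inl rfl⟩)
    rw [pairFun, List.map_cons, List.toFinset_cons, if_pos (Finset.mem_insert_self _ _),
      Finset.erase_insert (key _ h2), ih h4, if_neg, sub_zero]
    simp only [Finset.mem_insert, not_or]
    exact ⟨h1.symm, key _ h3⟩

theorem pairFun_map (g : Equiv.Perm ι) (L : List (ι × ι)) (A : Finset ι) :
    pairFun (L.map (Prod.map g g)) (A.map g.toEmbedding) = pairFun L A := by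
  induction L generalizing A with
  | nil => simp [pairFun]
  | cons p L ih =>
    have : ∀ y, (A.map g.toEmbedding).erase (g y) = (A.erase y).map g.toEmbedding := fun y =>
      (Finset.map_erase g.toEmbedding A y).symm
    have hm : ∀ y, g y ∈ A.map g.toEmbedding ↔ y ∈ A := fun y => Finset.mem_map' g.toEmbedding
    simp only [List.map_cons, pairFun, Prod.map_fst, Prod.map_snd, this, ih, hm]

theorem pairFun_map_swap {L : List (ι × ι)} (hL : (pairElems L).Nodup) {p : ι × ι} (hp : p ∈ L)
    (A : Finset ι) :
    pairFun (L.map (Prod.map (Equiv.swap p.1 p.2) (Equiv.swap p.1 p.2))) A = -pairFun L A := by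
  induction L generalizing A with
  | nil => simp at hp
  | cons q L ih =>
    rw [nodup_pairElems_cons] at hL
    obtain ⟨h1, h2, h3, h4⟩ := hL
    rcases List.mem_cons.1 hp with rfl | hp
    · have : L.map (Prod.map (Equiv.swap p.1 p.2) (Equiv.swap p.1 p.2)) = L := by
        refine (List.map_congr_left fun r hr => ?_).trans (List.map_id L)
        have k : ∀ z ∈ pairElems L, Equiv.swap p.1 p.2 z = z := fun z hz =>
          Equiv.swap_apply_of_ne_of_ne (by rintro rfl; exact h2 hz) (by rintro rfl; exact h3 hz)
        exact Prod.ext (k _ (mem_pairElems.2 ⟨r, hr, Or.inl rfl⟩))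
          (k _ (mem_pairElems.2 ⟨r, hr, Or.inr rfl⟩))
      simp [pairFun, this]
    · have k : ∀ z, z ∉ pairElems L → Equiv.swap p.1 p.2 z = z := fun z hz =>
        Equiv.swap_apply_of_ne_of_ne
          (by rintro rfl; exact hz (mem_pairElems.2 ⟨p, hp, Or.inl rfl⟩))
          (by rintro rfl; exact hz (mem_pairElems.2 ⟨p, hp, Or.inr rfl⟩))
      simp only [List.map_cons, pairFun, Prod.map_fst, Prod.map_snd, k _ h2, k _ h3, ih h4 hp]
      split_ifs <;> ring

theorem pairFun_swap {L : List (ι × ι)} (hL : (pairElems L).Nodup) {p : ι × ι} (hp : p ∈ L)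
    (A : Finset ι) : pairFun L (A.map (Equiv.swap p.1 p.2).toEmbedding) = -pairFun L A := by
  rw [← pairFun_map (Equiv.swap p.1 p.2) L A, pairFun_map_swap hL hp, neg_neg]

/-- A function that changes its sign under the transpositions of a list of disjoint pairs is
determined, among the functions supported on transversals, by one value. -/
theorem eq_zero_of_transversal {L : List (ι × ι)} (hL : (pairElems L).Nodup) {f : Finset ι → ℂ}
    (hanti : ∀ p ∈ L, ∀ A, f (A.map (Equiv.swap p.1 p.2).toEmbedding) = -f A)
    (hmem : ∀ A, f A ≠ 0 → ∀ x ∈ A, x ∈ pairElems L)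
    (hxor : ∀ A, f A ≠ 0 → ∀ p ∈ L, Xor (p.1 ∈ A) (p.2 ∈ A))
    (h1 : f (L.map Prod.fst).toFinset = 0) : f = 0 := by
  have hdisj : ∀ p ∈ L, ∀ q ∈ L, p.1 ≠ q.2 := by
    clear hanti hmem hxor h1
    induction L with
    | nil => simp
    | cons r L ih =>
      rw [nodup_pairElems_cons] at hL
      obtain ⟨k1, k2, k3, k4⟩ := hL
      intro p hp q hq
      rcases List.mem_cons.1 hp with hpr | hp' <;> rcases List.mem_cons.1 hq with hqr | hq'
      · rw [hpr, hqr]; exact k1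
      · rw [hpr]; intro h; exact k2 (mem_pairElems.2 ⟨q, hq', Or.inr h⟩)
      · rw [hqr]; intro h; exact k3 (mem_pairElems.2 ⟨p, hp', Or.inl h.symm⟩)
      · exact ih k4 p hp' q hq'
  set F := (L.map Prod.fst).toFinset with hF
  -- Induction on the number of elements of `A` outside the set `F` of first entries. Such an
  -- element is the second entry of some pair, and the transposition of that pair moves it into `F`
  -- at the cost of a sign.
  suffices H : ∀ m, ∀ A : Finset ι, (A \ F).card = m → f A = 0 from funext fun A => H _ A rfl
  intro m
  induction m with
  | zero =>
    intro A hA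
    by_contra h0
    have hsub : A ⊆ F := Finset.sdiff_eq_empty_iff_subset.1 (Finset.card_eq_zero.1 hA)
    apply h0
    rw [← h1]
    congr 1
    refine hsub.antisymm fun x hx => ?_
    simp only [hF, List.mem_toFinset, List.mem_map] at hx
    obtain ⟨p, hp, rfl⟩ := hx
    rcases hxor A h0 p hp with h | h
    · exact h.1
    · have := hsub h.1
      simp only [hF, List.mem_toFinset, List.mem_map] at this
      obtain ⟨q, hq, hqp⟩ := this
      exact absurd hqp (hdisj q hq p hp)
  | succ m ih =>
    intro A hA
    by_contra h0
    obtain ⟨y, hy⟩ : (A \ F).Nonempty := Finset.card_pos.1 (by omega)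
    rw [Finset.mem_sdiff] at hy
    obtain ⟨p, hp, hyp⟩ := mem_pairElems.1 (hmem A h0 y hy.1)
    have hpF : p.1 ∈ F := by
      simp only [hF, List.mem_toFinset, List.mem_map]
      exact ⟨p, hp, rfl⟩
    have hyp : y = p.2 := hyp.resolve_left (by rintro rfl; exact hy.2 hpF)
    subst hyp
    have hp1 : p.1 ∉ A := by
      rcases hxor A h0 p hp with h | h
      · exact absurd hy.1 h.2
      · exact h.2
    have := hanti p hp A
    rw [ih] at this
    · exact h0 (neg_eq_zero.1 this.symm)
    · have hset : A.map (Equiv.swap p.1 p.2).toEmbedding \ F = (A \ F).erase p.2 := by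
        ext z
        simp only [Finset.mem_sdiff, Finset.mem_erase, Finset.mem_map_equiv, Equiv.symm_swap]
        by_cases hz1 : z = p.1
        · subst hz1; simp [hpF]
        · by_cases hz2 : z = p.2
          · subst hz2; simp [hp1]
          · simp [Equiv.swap_apply_of_ne_of_ne hz1 hz2, hz2]
      rw [hset, Finset.card_erase_of_mem (Finset.mem_sdiff.2 hy), hA]
      rfl

theorem length_le_card_of_meets {L : List (ι × ι)} (hL : (pairElems L).Nodup) {B : Finset ι}
    (h : ∀ p ∈ L, p.1 ∈ B ∨ p.2 ∈ B) : L.length ≤ B.card := by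
  induction L generalizing B with
  | nil => simp
  | cons q L ih =>
    rw [nodup_pairElems_cons] at hL
    obtain ⟨h1, h2, h3, h4⟩ := hL
    have key : ∀ y ∈ B, y ∉ pairElems L → (q :: L).length ≤ B.card := by
      intro y hy hyL
      have := ih h4 (B := B.erase y) fun p hp => by
        have e1 : p.1 ≠ y := by
          rintro rfl; exact hyL (mem_pairElems.2 ⟨p, hp, Or.inl rfl⟩)
        have e2 : p.2 ≠ y := by
          rintro rfl; exact hyL (mem_pairElems.2 ⟨p, hp, Or.inr rfl⟩)
        simpa [e1, e2] using h p (List.mem_cons_of_mem _ hp)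
      rw [Finset.card_erase_of_mem hy] at this
      have := Finset.card_pos.2 ⟨y, hy⟩
      simp
      omega
    rcases h q (by simp) with hq | hq
    · exact key _ hq h2
    · exact key _ hq h3

/-- A set `B` with one element fewer than there are pairs misses some pair entirely. The
transposition of that pair fixes `B` and permutes the terms of `lower s f B`, so the sum equals its
own negative. -/
theorem lower_eq_zero_of_antisymmetric {L : List (ι × ι)} (hL : (pairElems L).Nodup)
    (s : Finset ι) (hs : ∀ x ∈ pairElems L, x ∈ s) {f : Finset ι → ℂ}
    (hanti : ∀ p ∈ L, ∀ A, f (A.map (Equiv.swap p.1 p.2).toEmbedding) = -f A)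
    (hcard : ∀ A, f A ≠ 0 → A.card = L.length) : lower s f = 0 := by
  ext B
  rw [lower_apply, Pi.zero_apply]
  by_cases hB : B.card + 1 = L.length
  · obtain ⟨p, hp, h1, h2⟩ : ∃ p ∈ L, p.1 ∉ B ∧ p.2 ∉ B := by
      by_contra hne
      push Not at hne
      have := length_le_card_of_meets hL (B := B) fun p hp => by
        by_cases h : p.1 ∈ B
        · exact Or.inl h
        · exact Or.inr (hne p hp h)
      omega
    have hs1 : p.1 ∈ s := hs _ (mem_pairElems.2 ⟨p, hp, Or.inl rfl⟩)
    have hs2 : p.2 ∈ s := hs _ (mem_pairElems.2 ⟨p, hp, Or.inr rfl⟩)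
    have hBfix : B.map (Equiv.swap p.1 p.2).toEmbedding = B := by
      ext z
      simp only [Finset.mem_map_equiv, Equiv.symm_swap]
      by_cases hz1 : z = p.1
      · subst hz1; simp [h1, h2]
      · by_cases hz2 : z = p.2
        · subst hz2; simp [h1, h2]
        · simp [Equiv.swap_apply_of_ne_of_ne hz1 hz2]
    have hmem : ∀ x, x ∈ s \ B → Equiv.swap p.1 p.2 x ∈ s \ B := by
      intro z hz
      by_cases hz1 : z = p.1
      · subst hz1; simp [hs2, h2]
      · by_cases hz2 : z = p.2
        · subst hz2; simp [hs1, h1]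
        · simpa [Equiv.swap_apply_of_ne_of_ne hz1 hz2] using hz
    have : ∑ x ∈ s \ B, f (insert x B) = ∑ x ∈ s \ B, -f (insert x B) := by
      refine Finset.sum_bij' (fun x _ => Equiv.swap p.1 p.2 x) (fun x _ => Equiv.swap p.1 p.2 x)
        hmem hmem (by simp) (by simp) fun x _ => ?_
      rw [← hanti p hp, Finset.map_insert, hBfix]
      simp
    rw [Finset.sum_neg_distrib] at this
    exact self_eq_neg.1 this
  · refine Finset.sum_eq_zero fun x hx => ?_
    by_contra h0
    rw [Finset.mem_sdiff] at hx
    have := hcard _ h0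
    rw [Finset.card_insert_of_notMem hx.2] at this
    exact hB this

theorem lower_pairFun {L : List (ι × ι)} (hL : (pairElems L).Nodup)
    (s : Finset ι) (hs : ∀ x ∈ pairElems L, x ∈ s) : lower s (pairFun L) = 0 :=
  lower_eq_zero_of_antisymmetric hL s hs (fun _ hp A => pairFun_swap hL hp A)
    fun _ h => card_of_pairFun_ne_zero h

/-- The functions `pairFun L` for the lists `L` of `k` disjoint pairs in `s`. -/
def pairFuns (s : Finset ι) (k : ℕ) : Set (Finset ι → ℂ) :=
  {f | ∃ L : List (ι × ι), (pairElems L).Nodup ∧ L.length = k ∧ (∀ x ∈ pairElems L, x ∈ s) ∧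
    f = pairFun L}

theorem pairFuns_mono {s t : Finset ι} (h : s ⊆ t) (k : ℕ) : pairFuns s k ⊆ pairFuns t k := by
  rintro _ ⟨L, h1, h2, h3, rfl⟩
  exact ⟨L, h1, h2, fun x hx => h (h3 x hx), rfl⟩

theorem span_pairFuns_le (s : Finset ι) (k : ℕ) {f : Finset ι → ℂ}
    (hf : f ∈ Submodule.span ℂ (pairFuns s k)) :
    (∀ A, f A ≠ 0 → A ⊆ s ∧ A.card = k) ∧ lower s f = 0 := by
  induction hf using Submodule.span_induction with
  | mem f h =>
    obtain ⟨L, h1, h2, h3, rfl⟩ := h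
    exact ⟨fun A hA => ⟨fun x hx => h3 x (mem_pairElems_of_pairFun_ne_zero hA hx),
      (card_of_pairFun_ne_zero hA).trans h2⟩, lower_pairFun h1 s h3⟩
  | zero => simp
  | add f g _ _ hf hg =>
    refine ⟨fun A hA => ?_, by rw [map_add, hf.2, hg.2, add_zero]⟩
    by_cases h : f A = 0
    · exact hg.1 A fun h' => hA (by simp [h, h'])
    · exact hf.1 A h
  | smul c f _ hf =>
    refine ⟨fun A hA => hf.1 A fun h => hA (by simp [h]), by rw [map_smul, hf.2, smul_zero]⟩

/-- Multiplication by `x_c - x_d`, where `d ∈ s` occurs in no pair, has the given product as its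
coefficient of `x_c`. The bound `2 * k < s.card` leaves room for `d`, which may differ between the
products. -/
theorem exists_lift_pairFuns (s : Finset ι) (c : ι) (hc : c ∉ s) (k : ℕ)
    (hk : 2 * k < s.card) {f : Finset ι → ℂ} (hf : f ∈ Submodule.span ℂ (pairFuns s k)) :
    ∃ g ∈ Submodule.span ℂ (pairFuns (insert c s) (k + 1)),
      ∀ B, c ∉ B → g (insert c B) = f B := by
  induction hf using Submodule.span_induction with
  | mem f h =>
    obtain ⟨L, h1, h2, h3, rfl⟩ := h
    obtain ⟨d, hds, hdL⟩ : ∃ d ∈ s, d ∉ (pairElems L).toFinset := by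
      apply Finset.exists_mem_notMem_of_card_lt_card
      have := List.toFinset_card_le (pairElems L)
      rw [length_pairElems] at this
      omega
    rw [List.mem_toFinset] at hdL
    have hcL : c ∉ pairElems L := fun h => hc (h3 c h)
    have hcd : c ≠ d := by rintro rfl; exact hc hds
    refine ⟨pairFun ((c, d) :: L), Submodule.subset_span ⟨_, ?_, by simp [h2], ?_, rfl⟩, ?_⟩
    · exact nodup_pairElems_cons.2 ⟨hcd, hcL, hdL, h1⟩
    · intro x hx
      simp only [pairElems_cons, List.mem_cons] at hx
      rcases hx with rfl | rfl | hx
      · simp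
      · simp [hds]
      · simp [h3 x hx]
    · intro B hB
      have h0 : pairFun L ((insert c B).erase d) = 0 := by
        by_contra h0
        exact hcL (mem_pairElems_of_pairFun_ne_zero h0 (by simp [hcd]))
      simp [pairFun, h0, hB]
  | zero => exact ⟨0, Submodule.zero_mem _, by simp⟩
  | add f g _ _ hf hg =>
    obtain ⟨f', hf', hf⟩ := hf
    obtain ⟨g', hg', hg⟩ := hg
    exact ⟨f' + g', Submodule.add_mem _ hf' hg', fun B hB => by simp [hf B hB, hg B hB]⟩
  | smul a f _ hf =>
    obtain ⟨f', hf', hf⟩ := hf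
    exact ⟨a • f', Submodule.smul_mem _ a hf', fun B hB => by simp [hf B hB]⟩

/-- Induction on `s`. With `f` read as a squarefree polynomial, `lower s` is the sum of the partial
derivatives over `s`. The coefficient of `x_c` in `f` is again in a kernel, so it is a combination
of products and lifts to some `g`; then `f - g` does not involve `x_c`, and the induction hypothesis
applies to it as well. -/
theorem mem_span_pairFuns [Fintype ι] (s : Finset ι) (k : ℕ) (f : Finset ι → ℂ)
    (hf : ∀ A, f A ≠ 0 → A ⊆ s ∧ A.card = k) (h : lower s f = 0) :
    f ∈ Submodule.span ℂ (pairFuns s k) := by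
  induction s using Finset.induction_on generalizing k f with
  | empty =>
    rcases Nat.eq_zero_or_pos k with rfl | hk
    · have : f = f ∅ • pairFun [] := by
        ext A
        by_cases hA : A = ∅
        · simp [hA, pairFun]
        · have : f A = 0 := by
            by_contra h0
            exact hA (Finset.subset_empty.1 (hf A h0).1)
          simp [pairFun, hA, this]
      rw [this]
      exact Submodule.smul_mem _ _ (Submodule.subset_span ⟨[], by simp, rfl, by simp, rfl⟩)
    · rw [eq_zero_of_lower_eq_zero ∅ k (by simpa using hk) f hf h]
      exact Submodule.zero_mem _
  | insert c s hc ih =>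
    -- Above the middle level lowering is injective, so only `2 * k ≤ (insert c s).card` matters.
    -- This is also the bound that the lift needs one level lower.
    by_cases hcard : (insert c s).card < 2 * k
    · rw [eq_zero_of_lower_eq_zero _ k hcard f hf h]
      exact Submodule.zero_mem _
    rw [Finset.card_insert_of_notMem hc] at hcard
    have lower_eq : ∀ B, lower (insert c s) f B =
        lower s f B + if c ∉ B then f (insert c B) else 0 := by
      intro B
      rw [lower_apply, lower_apply]
      by_cases hB : c ∈ B
      · rw [Finset.insert_sdiff_of_mem _ hB, if_neg (not_not.2 hB), add_zero]
      · rw [Finset.insert_sdiff_of_notMem _ hB, Finset.sum_insert (by simp [hc]), if_pos hB,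
          add_comm]
    obtain ⟨g, hg, hgf⟩ : ∃ g ∈ Submodule.span ℂ (pairFuns (insert c s) k),
        ∀ B, c ∉ B → g (insert c B) = f (insert c B) := by
      cases k with
      | zero =>
        refine ⟨0, Submodule.zero_mem _, fun B _ => ?_⟩
        by_contra h0
        have := (hf _ fun h => h0 h.symm).2
        simp at this
      | succ k =>
        -- The coefficient of `x_c` in `f`, of degree one less.
        let r : Finset ι → ℂ := fun B => if c ∈ B then 0 else f (insert c B)
        have hr : r ∈ Submodule.span ℂ (pairFuns s k) := by
          apply ih
          · intro A hA
            by_cases hcA : c ∈ A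
            · simp [r, hcA] at hA
            · have h1 := hf (insert c A) (by simpa [r, hcA] using hA)
              rw [Finset.card_insert_of_notMem hcA] at h1
              exact ⟨(Finset.insert_subset_insert_iff hcA).1 h1.1, by omega⟩
          · ext B
            rw [lower_apply, Pi.zero_apply]
            by_cases hcB : c ∈ B
            · exact Finset.sum_eq_zero fun x _ => by simp [r, hcB]
            · have h1 := congrFun h (insert c B)
              rw [lower_apply, Finset.insert_sdiff_insert, Pi.zero_apply] at h1
              have h2 : s \ insert c B = s \ B := by
                ext z
                simp only [Finset.mem_sdiff, Finset.mem_insert, not_or]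
                refine ⟨fun hz => ⟨hz.1, hz.2.2⟩, fun hz => ⟨hz.1, ?_, hz.2⟩⟩
                rintro rfl
                exact hc hz.1
              rw [h2] at h1
              rw [← h1]
              refine Finset.sum_congr rfl fun x hx => ?_
              have hxc : x ≠ c := by
                rintro rfl
                exact hc (Finset.mem_sdiff.1 hx).1
              simp only [r, Finset.mem_insert, hcB, or_false, hxc.symm, if_false]
              rw [Finset.insert_comm]
        obtain ⟨g, hg, hgr⟩ := exists_lift_pairFuns s c hc k (by omega) hr
        exact ⟨g, hg, fun B hB => by rw [hgr B hB]; simp [r, hB]⟩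
    obtain ⟨hg1, hg2⟩ := span_pairFuns_le _ _ hg
    have hvan : ∀ A, c ∈ A → (f - g) A = 0 := by
      intro A hA
      have := hgf (A.erase c) (Finset.notMem_erase c A)
      rw [Finset.insert_erase hA] at this
      simp [this]
    have hfg : f - g ∈ Submodule.span ℂ (pairFuns s k) := by
      apply ih
      · intro A hA
        have hcA : c ∉ A := fun h => hA (hvan A h)
        have : A ⊆ insert c s ∧ A.card = k := by
          by_cases h0 : f A = 0
          · exact hg1 A fun h' => hA (by simp [h0, h'])
          · exact hf A h0
        exact ⟨(Finset.subset_insert_iff_of_notMem hcA).1 this.1, this.2⟩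
      · ext B
        have h1 : lower (insert c s) (f - g) B = 0 := by rw [map_sub, h, hg2]; simp
        rw [lower_apply] at h1
        rw [lower_apply, Pi.zero_apply, ← h1]
        refine Finset.sum_subset (Finset.sdiff_subset_sdiff (Finset.subset_insert c s) subset_rfl)
          fun x hx hx' => ?_
        have hxc : x = c := by
          by_contra hxc
          simp only [Finset.mem_sdiff, Finset.mem_insert, hxc, false_or] at hx hx'
          exact hx' hx
        subst hxc
        exact hvan _ (Finset.mem_insert_self _ _)
    have : f = (f - g) + g := by simp
    rw [this]
    exact Submodule.add_mem _ (Submodule.span_mono (pairFuns_mono (Finset.subset_insert c s) k) hfg)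
      hg

end PairFun

/-! ### Multiplicities in a direct sum. -/

section Hom

variable {G V V₁ V₂ W : Type*} [Group G] [AddCommGroup V] [Module ℂ V] [AddCommGroup V₁]
  [Module ℂ V₁] [AddCommGroup V₂] [Module ℂ V₂] [AddCommGroup W] [Module ℂ W]
  [FiniteDimensional ℂ V₁] [FiniteDimensional ℂ V₂] [FiniteDimensional ℂ W]

/-- Multiplicities are additive in a direct sum decomposition of the first representation. -/
theorem multiplicity_add_of_bijective {σ : Representation ℂ G V} {σ₁ : Representation ℂ G V₁}
    {σ₂ : Representation ℂ G V₂} (ρ : Representation ℂ G W)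
    (a : Representation.IntertwiningMap σ₁ σ) (b : Representation.IntertwiningMap σ₂ σ)
    (h : Function.Bijective (a.toLinearMap.coprod b.toLinearMap)) :
    multiplicity σ₁ ρ + multiplicity σ₂ ρ = multiplicity σ ρ := by
  have hadd : multiplicity σ₁ ρ + multiplicity σ₂ ρ =
      Module.finrank ℂ (Representation.IntertwiningMap σ₁ ρ ×
        Representation.IntertwiningMap σ₂ ρ) := (Module.finrank_prod).symm
  rw [hadd]
  symm
  -- Restriction to the two summands. The inverse glues a pair of maps along the decomposition `e`.
  let T : Representation.IntertwiningMap σ ρ →ₗ[ℂ]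
      Representation.IntertwiningMap σ₁ ρ × Representation.IntertwiningMap σ₂ ρ :=
    { toFun := fun φ => (φ.comp a, φ.comp b)
      map_add' := fun _ _ => rfl
      map_smul' := fun _ _ => rfl }
  let e := LinearEquiv.ofBijective _ h
  refine LinearEquiv.finrank_eq (LinearEquiv.ofBijective T ⟨?_, ?_⟩)
  · rw [injective_iff_map_eq_zero]
    intro φ hφ
    have h1 : φ.comp a = 0 := congrArg Prod.fst hφ
    have h2 : φ.comp b = 0 := congrArg Prod.snd hφ
    ext v
    obtain ⟨⟨x, y⟩, rfl⟩ := h.2 v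
    have h1' : φ (a x) = 0 := DFunLike.congr_fun h1 x
    have h2' : φ (b y) = 0 := DFunLike.congr_fun h2 y
    change φ (a x + b y) = 0
    rw [map_add, h1', h2', add_zero]
  · rintro ⟨c, d⟩
    have hinv : ∀ x y, (c.toLinearMap.coprod d.toLinearMap ∘ₗ e.symm.toLinearMap) (a x + b y) =
        c x + d y := by
      intro x y
      have : a x + b y = e (x, y) := rfl
      rw [this, LinearMap.comp_apply, LinearEquiv.coe_coe, LinearEquiv.symm_apply_apply]
      rfl
    refine ⟨LinearMap.intertwiningMap_of_isIntertwiningMap _ _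
      (c.toLinearMap.coprod d.toLinearMap ∘ₗ e.symm.toLinearMap) ?_, ?_⟩
    · intro g v
      obtain ⟨⟨x, y⟩, rfl⟩ := h.2 v
      have : σ g (a.toLinearMap.coprod b.toLinearMap (x, y)) = a (σ₁ g x) + b (σ₂ g y) := by
        rw [a.isIntertwining, b.isIntertwining, ← map_add]
        rfl
      rw [this, hinv]
      have : a.toLinearMap.coprod b.toLinearMap (x, y) = a x + b y := rfl
      rw [this, hinv, c.isIntertwining, d.isIntertwining, map_add]
    · refine Prod.ext ?_ ?_
      · ext x
        have := hinv x 0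
        rw [map_zero, map_zero, add_zero, add_zero] at this
        exact this
      · ext y
        have := hinv 0 y
        rw [map_zero, map_zero, zero_add, zero_add] at this
        exact this

end Hom

/-! ### Permutation modules on subsets, embedded in the functions on the Boolean lattice. -/

section Subsets

/-- The subsets `A` of `Fin n` with `#A + i = k`. -/
abbrev SubsetsOfCard (n k i : ℕ) : Type := {A : Finset (Fin n) // A.card + i = k}

instance subsetsAction (n k i : ℕ) : MulAction (Equiv.Perm (Fin n)) (SubsetsOfCard n k i) where
  smul g A := ⟨A.1.map g.toEmbedding, by rw [Finset.card_map]; exact A.2⟩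
  one_smul A := Subtype.ext (by ext x; exact Finset.mem_map_equiv)
  mul_smul g h A := Subtype.ext (by
    change A.1.map _ = (A.1.map _).map _
    rw [Finset.map_map]
    rfl)

theorem coe_smul_subset {n k i : ℕ} (g : Equiv.Perm (Fin n)) (A : SubsetsOfCard n k i) :
    (g • A).1 = A.1.map g.toEmbedding := rfl

variable {n : ℕ} {Ω : Type*}

/-- The linear extension to formal sums of a map to the Boolean lattice. -/
def powersetSum (r : Ω → Finset (Fin n)) : ℂ[Ω] →ₗ[ℂ] (Finset (Fin n) → ℂ) :=
  Finsupp.linearCombination ℂ (fun x => Pi.single (r x) (1 : ℂ)) ∘ₗ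
    (MonoidAlgebra.coeffLinearEquiv ℂ).toLinearMap

theorem powersetSum_single (r : Ω → Finset (Fin n)) (x : Ω) (c : ℂ) :
    powersetSum r (MonoidAlgebra.single x c) = c • Pi.single (r x) (1 : ℂ) := by
  simp [powersetSum]

theorem powersetSum_apply {r : Ω → Finset (Fin n)} (hr : Function.Injective r) (v : ℂ[Ω]) (x : Ω) :
    powersetSum r v (r x) = v.coeff x := by
  suffices h : LinearMap.proj (r x) ∘ₗ powersetSum r =
      Finsupp.lapply x ∘ₗ (MonoidAlgebra.coeffLinearEquiv ℂ).toLinearMap from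
    LinearMap.congr_fun h v
  ext y
  by_cases hxy : r x = r y
  · obtain rfl := hr hxy
    simp [powersetSum_single]
  · have : y ≠ x := by rintro rfl; exact hxy rfl
    simp [powersetSum_single, hxy, this]

theorem powersetSum_eq_zero_of_notMem {r : Ω → Finset (Fin n)} (v : ℂ[Ω]) {A : Finset (Fin n)}
    (hA : ∀ x, r x ≠ A) : powersetSum r v A = 0 := by
  suffices h : LinearMap.proj A ∘ₗ powersetSum r = 0 from LinearMap.congr_fun h v
  ext y
  simp [powersetSum_single, (hA y).symm]

theorem powersetSum_injective {r : Ω → Finset (Fin n)} (hr : Function.Injective r) :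
    Function.Injective (powersetSum r) := by
  intro v w h
  ext x
  rw [← powersetSum_apply hr, h, powersetSum_apply hr]

/-- The action of the symmetric group on functions on the Boolean lattice. -/
def permFun (g : Equiv.Perm (Fin n)) : (Finset (Fin n) → ℂ) →ₗ[ℂ] (Finset (Fin n) → ℂ) :=
  LinearMap.funLeft ℂ ℂ fun A => A.map (g⁻¹).toEmbedding

theorem permFun_apply (g : Equiv.Perm (Fin n)) (f : Finset (Fin n) → ℂ) (A : Finset (Fin n)) :
    permFun g f A = f (A.map (g⁻¹).toEmbedding) := rfl

theorem map_inv_map (g : Equiv.Perm (Fin n)) (A : Finset (Fin n)) :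
    (A.map g.toEmbedding).map (g⁻¹).toEmbedding = A := by
  ext x
  rw [Finset.mem_map_equiv, Finset.mem_map_equiv]
  change g.symm (g x) ∈ A ↔ _
  simp

theorem map_map_inv (g : Equiv.Perm (Fin n)) (A : Finset (Fin n)) :
    (A.map (g⁻¹).toEmbedding).map g.toEmbedding = A := by
  ext x
  rw [Finset.mem_map_equiv, Finset.mem_map_equiv]
  change g (g.symm x) ∈ A ↔ _
  simp

theorem powersetSum_ofMulAction [MulAction (Equiv.Perm (Fin n)) Ω] {r : Ω → Finset (Fin n)}
    (hr : ∀ (g : Equiv.Perm (Fin n)) x, r (g • x) = (r x).map g.toEmbedding)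
    (g : Equiv.Perm (Fin n)) (v : ℂ[Ω]) :
    powersetSum r (Representation.ofMulAction ℂ _ Ω g v) = permFun g (powersetSum r v) := by
  suffices h : powersetSum r ∘ₗ Representation.ofMulAction ℂ _ Ω g = permFun g ∘ₗ powersetSum r from
    LinearMap.congr_fun h v
  ext x A
  have : A.map (g⁻¹).toEmbedding = r x ↔ A = (r x).map g.toEmbedding :=
    ⟨fun h => by rw [← h, map_map_inv], fun h => by rw [h, map_inv_map]⟩
  simp [powersetSum_single, permFun_apply, Pi.single_apply, hr, this]

theorem raise_permFun (g : Equiv.Perm (Fin n)) (f : Finset (Fin n) → ℂ) :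
    raise Finset.univ (permFun g f) = permFun g (raise Finset.univ f) := by
  ext A
  rw [permFun_apply, raise_apply, raise_apply, Finset.inter_univ, Finset.inter_univ, Finset.sum_map]
  refine Finset.sum_congr rfl fun x _ => ?_
  rw [permFun_apply, Finset.map_erase]

theorem lower_eq_zero_of_card {k : ℕ} {f : Finset (Fin n) → ℂ}
    (hf : ∀ A, f A ≠ 0 → A.card = k) {B : Finset (Fin n)} (hB : B.card + 1 ≠ k) :
    lower Finset.univ f B = 0 := by
  refine Finset.sum_eq_zero fun x hx => ?_
  by_contra h0
  have := hf _ h0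
  rw [Finset.card_insert_of_notMem (Finset.mem_sdiff.1 hx).2] at this
  exact hB this

theorem raise_eq_zero_of_card {k : ℕ} {f : Finset (Fin n) → ℂ}
    (hf : ∀ A, f A ≠ 0 → A.card + 1 = k) {B : Finset (Fin n)} (hB : B.card ≠ k) :
    raise Finset.univ f B = 0 := by
  refine Finset.sum_eq_zero fun x hx => ?_
  by_contra h0
  have := hf _ h0
  rw [Finset.inter_univ] at hx
  rw [Finset.card_erase_add_one hx] at this
  exact hB this

/-- The restriction of a function on the Boolean lattice to subsets of given cardinality. -/
def restrictCard (n k i : ℕ) : (Finset (Fin n) → ℂ) →ₗ[ℂ] ℂ[SubsetsOfCard n k i] :=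
  (MonoidAlgebra.coeffLinearEquiv ℂ).symm.toLinearMap ∘ₗ
    (Finsupp.linearEquivFunOnFinite ℂ ℂ (SubsetsOfCard n k i)).symm.toLinearMap ∘ₗ
      LinearMap.funLeft ℂ ℂ Subtype.val

theorem coeff_restrictCard (k i : ℕ) (f : Finset (Fin n) → ℂ) (A : SubsetsOfCard n k i) :
    (restrictCard n k i f).coeff A = f A.1 := rfl

theorem powersetSum_restrictCard (k i : ℕ) (f : Finset (Fin n) → ℂ)
    (hf : ∀ A, f A ≠ 0 → A.card + i = k) :
    powersetSum (Subtype.val : SubsetsOfCard n k i → _) (restrictCard n k i f) = f := by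
  ext A
  by_cases hA : A.card + i = k
  · exact powersetSum_apply Subtype.val_injective _ (⟨A, hA⟩ : SubsetsOfCard n k i)
  · rw [powersetSum_eq_zero_of_notMem]
    · by_contra h0
      exact hA (hf A (Ne.symm h0))
    · rintro ⟨B, hB⟩ rfl
      exact hA hB

theorem restrictCard_permFun (k i : ℕ) (g : Equiv.Perm (Fin n)) (f : Finset (Fin n) → ℂ) :
    restrictCard n k i (permFun g f) =
      Representation.ofMulAction ℂ _ (SubsetsOfCard n k i) g (restrictCard n k i f) := by
  ext A
  rw [Representation.coeff_ofMulAction, coeff_restrictCard, coeff_restrictCard]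
  rfl

theorem card_of_powersetSum_ne_zero {k i : ℕ} {v : ℂ[SubsetsOfCard n k i]} {A : Finset (Fin n)}
    (h : powersetSum Subtype.val v A ≠ 0) : A.card + i = k := by
  by_contra hA
  apply h
  apply powersetSum_eq_zero_of_notMem
  rintro ⟨B, hB⟩ rfl
  exact hA hB

end Subsets

/-! ### Two-row Specht modules as kernels of the lowering operator. -/

section SpechtTwoRow

variable {n k : ℕ} {hk : k ≤ n - k}

theorem mem_twoRow {a b : ℕ} {h : b ≤ a} {c : ℕ × ℕ} :
    c ∈ (twoRow a b h).cells ↔ (c.1 = 0 ∧ c.2 < a) ∨ (c.1 = 1 ∧ c.2 < b) := by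
  rw [YoungDiagram.mem_cells, twoRow, YoungDiagram.mem_ofRowLens]
  obtain ⟨i, j⟩ := c
  match i with
  | 0 => simp
  | 1 => simp
  | i + 2 => simp

/-- The second row of a tabloid. -/
def secondRow {μ : YoungDiagram} (r : Tabloid μ n) : Finset (Fin n) :=
  Finset.univ.filter fun x => r.1 x = 1

theorem mem_secondRow {μ : YoungDiagram} {r : Tabloid μ n} {x : Fin n} :
    x ∈ secondRow r ↔ r.1 x = 1 := by simp [secondRow]

theorem secondRow_smul {μ : YoungDiagram} (g : Equiv.Perm (Fin n)) (r : Tabloid μ n) :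
    secondRow (g • r) = (secondRow r).map g.toEmbedding := by
  ext x
  rw [Finset.mem_map_equiv, mem_secondRow, mem_secondRow]
  rfl

theorem rowOf_twoRow {a b : ℕ} {h : b ≤ a} (t : Tableau (twoRow a b h) n) (x : Fin n) :
    rowOf t x = 0 ∨ rowOf t x = 1 := by
  have := mem_twoRow.1 (t.symm x).2
  unfold rowOf
  tauto

/-- With only two rows, a tabloid is determined by its second row; thus tabloids become `k`-subsets.
-/
theorem secondRow_injective {a b : ℕ} {h : b ≤ a} :
    Function.Injective (secondRow : Tabloid (twoRow a b h) n → _) := by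
  rintro ⟨_, t, rfl⟩ ⟨_, u, rfl⟩ htu
  refine Subtype.ext (funext fun x => ?_)
  have := Finset.ext_iff.1 htu x
  rw [mem_secondRow, mem_secondRow] at this
  change rowOf t x = 1 ↔ rowOf u x = 1 at this
  change rowOf t x = rowOf u x
  rcases rowOf_twoRow t x with h1 | h1 <;> rcases rowOf_twoRow u x with h2 | h2 <;> simp_all

/-- The list of the pairs of entries in the columns of length two of a tableau. -/
def columnPairs (t : Tableau (twoRow (n - k) k hk) n) : List (Fin n × Fin n) :=
  List.ofFn fun i : Fin k =>
    (t ⟨(1, i), mem_twoRow.2 (Or.inr ⟨rfl, i.2⟩)⟩,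
      t ⟨(0, i), mem_twoRow.2 (Or.inl ⟨rfl, i.2.trans_le hk⟩)⟩)

theorem mem_columnPairs {t : Tableau (twoRow (n - k) k hk) n} {p : Fin n × Fin n} :
    p ∈ columnPairs t ↔ rowOf t p.1 = 1 ∧ rowOf t p.2 = 0 ∧ colOf t p.1 = colOf t p.2 := by
  rw [columnPairs, List.mem_ofFn]
  constructor
  · rintro ⟨i, rfl⟩
    simp [rowOf, colOf]
  · rintro ⟨h1, h2, h3⟩
    have hc : colOf t p.1 < k := by
      have := mem_twoRow.1 (t.symm p.1).2
      unfold rowOf at h1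
      unfold colOf
      omega
    refine ⟨⟨colOf t p.1, hc⟩, Prod.ext ?_ ?_⟩
    · refine t.eq_symm_apply.1 (Subtype.ext (Prod.ext ?_ rfl))
      exact h1.symm
    · refine t.eq_symm_apply.1 (Subtype.ext (Prod.ext ?_ ?_))
      · exact h2.symm
      · exact h3

theorem eq_of_rowOf_of_colOf {μ : YoungDiagram} (t : Tableau μ n) {x y : Fin n}
    (h1 : rowOf t x = rowOf t y) (h2 : colOf t x = colOf t y) : x = y :=
  t.symm.injective (Subtype.ext (Prod.ext h1 h2))

theorem colOf_lt_of_rowOf {t : Tableau (twoRow (n - k) k hk) n} {x : Fin n} (h : rowOf t x = 1) :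
    colOf t x < k := by
  have := mem_twoRow.1 (t.symm x).2
  unfold rowOf at h
  unfold colOf
  omega

theorem mem_pairElems_columnPairs {t : Tableau (twoRow (n - k) k hk) n} {x : Fin n}
    (hx : colOf t x < k) : x ∈ pairElems (columnPairs t) := by
  rw [mem_pairElems]
  rcases rowOf_twoRow t x with h | h
  · refine ⟨(t ⟨(1, colOf t x), mem_twoRow.2 (Or.inr ⟨rfl, hx⟩)⟩, x),
      mem_columnPairs.2 ⟨?_, h, ?_⟩, Or.inr rfl⟩
    · simp [rowOf]
    · simp [colOf]
  · refine ⟨(x, t ⟨(0, colOf t x), mem_twoRow.2 (Or.inl ⟨rfl, hx.trans_le hk⟩)⟩),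
      mem_columnPairs.2 ⟨h, ?_, ?_⟩, Or.inl rfl⟩
    · simp [rowOf]
    · simp [colOf]

theorem nodup_columnPairs (t : Tableau (twoRow (n - k) k hk) n) :
    (pairElems (columnPairs t)).Nodup := by
  rw [pairElems, List.nodup_flatMap]
  constructor
  · intro p hp
    obtain ⟨h1, h2, -⟩ := mem_columnPairs.1 hp
    have : p.1 ≠ p.2 := fun h => by rw [h] at h1; omega
    simpa using this
  · rw [columnPairs, List.pairwise_ofFn]
    intro i j hij x hx hx'
    have h : ∀ i : Fin k, x ∈ [t ⟨(1, i), mem_twoRow.2 (Or.inr ⟨rfl, i.2⟩)⟩,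
        t ⟨(0, i), mem_twoRow.2 (Or.inl ⟨rfl, i.2.trans_le hk⟩)⟩] → colOf t x = i := by
      intro i hi
      simp only [List.mem_cons, List.not_mem_nil, or_false] at hi
      rcases hi with rfl | rfl <;> simp [colOf]
    have := (h i hx).symm.trans (h j hx')
    exact hij.ne (Fin.ext this)

theorem length_columnPairs (t : Tableau (twoRow (n - k) k hk) n) : (columnPairs t).length = k := by
  simp [columnPairs]

theorem firsts_columnPairs (t : Tableau (twoRow (n - k) k hk) n) :
    ((columnPairs t).map Prod.fst).toFinset = secondRow (tabloid t) := by
  ext x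
  rw [List.mem_toFinset, List.mem_map, mem_secondRow]
  constructor
  · rintro ⟨p, hp, rfl⟩
    exact (mem_columnPairs.1 hp).1
  · intro h
    have h' : rowOf t x = 1 := h
    refine ⟨(x, t ⟨(0, colOf t x),
      mem_twoRow.2 (Or.inl ⟨rfl, (colOf_lt_of_rowOf h').trans_le hk⟩)⟩),
      mem_columnPairs.2 ⟨h', ?_, ?_⟩, rfl⟩
    · simp [rowOf]
    · simp [colOf]

theorem mem_colStabilizer {μ : YoungDiagram} {t : Tableau μ n} {g : Equiv.Perm (Fin n)} :
    g ∈ colStabilizer t ↔ ∀ x, colOf t (g x) = colOf t x := by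
  simp [colStabilizer]

theorem powersetSum_polytabloid_apply {μ : YoungDiagram} (t : Tableau μ n) (A : Finset (Fin n)) :
    powersetSum secondRow (polytabloid t) A = ∑ g ∈ colStabilizer t,
      if A = (secondRow (tabloid t)).map g.toEmbedding then
        (((Equiv.Perm.sign g : ℤˣ) : ℤ) : ℂ) else 0 := by
  rw [polytabloid, map_sum, Finset.sum_apply]
  refine Finset.sum_congr rfl fun g _ => ?_
  rw [powersetSum_single, secondRow_smul, Pi.smul_apply, Pi.single_apply, smul_eq_mul]
  simp

theorem exists_of_powersetSum_polytabloid_ne_zero {μ : YoungDiagram} {t : Tableau μ n}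
    {A : Finset (Fin n)} (h : powersetSum secondRow (polytabloid t) A ≠ 0) :
    ∃ g ∈ colStabilizer t, A = (secondRow (tabloid t)).map g.toEmbedding := by
  rw [powersetSum_polytabloid_apply] at h
  obtain ⟨g, hg, h⟩ := Finset.exists_ne_zero_of_sum_ne_zero h
  exact ⟨g, hg, by_contra fun hA => h (if_neg hA)⟩

/-- Both sides change sign under the transposition of a column, are supported on sets with one entry
from each column of length two, and take the value `1` on the second row of `t`. By
`eq_zero_of_transversal` they agree. -/
theorem powersetSum_polytabloid (t : Tableau (twoRow (n - k) k hk) n) :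
    powersetSum secondRow (polytabloid t) = pairFun (columnPairs t) := by
  rw [← sub_eq_zero]
  have hL := nodup_columnPairs t
  have hne : ∀ A, (powersetSum secondRow (polytabloid t) - pairFun (columnPairs t)) A ≠ 0 →
      powersetSum secondRow (polytabloid t) A ≠ 0 ∨ pairFun (columnPairs t) A ≠ 0 := by
    intro A hA
    by_contra! h
    exact hA (by simp [h.1, h.2])
  have hmem : ∀ (g : Equiv.Perm (Fin n)) x,
      x ∈ (secondRow (tabloid t)).map g.toEmbedding ↔ rowOf t (g.symm x) = 1 := by
    intro g x
    rw [Finset.mem_map_equiv, mem_secondRow]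
    rfl
  have hcol : ∀ g ∈ colStabilizer t, ∀ x, colOf t (g.symm x) = colOf t x := by
    intro g hg x
    have := mem_colStabilizer.1 hg (g.symm x)
    rwa [Equiv.apply_symm_apply, eq_comm] at this
  refine eq_zero_of_transversal hL ?_ ?_ ?_ ?_
  · intro p hp A
    obtain ⟨hp1, hp2, hp3⟩ := mem_columnPairs.1 hp
    have hpp : p.1 ≠ p.2 := fun h => by rw [h] at hp1; omega
    rw [Pi.sub_apply, Pi.sub_apply, pairFun_swap hL hp, neg_sub, sub_neg_eq_add, add_comm,
      sub_eq_add_neg]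
    congr 1
    rw [powersetSum_polytabloid_apply, powersetSum_polytabloid_apply, ← Finset.sum_neg_distrib]
    have hτ : ∀ g ∈ colStabilizer t, Equiv.swap p.1 p.2 * g ∈ colStabilizer t := by
      intro g hg
      rw [mem_colStabilizer] at hg ⊢
      intro x
      rw [Equiv.Perm.mul_apply, ← hg x]
      by_cases h1 : g x = p.1
      · rw [h1, Equiv.swap_apply_left, hp3]
      · by_cases h2 : g x = p.2
        · rw [h2, Equiv.swap_apply_right, hp3]
        · rw [Equiv.swap_apply_of_ne_of_ne h1 h2]
    refine Finset.sum_bij' (fun g _ => Equiv.swap p.1 p.2 * g) (fun g _ => Equiv.swap p.1 p.2 * g)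
      hτ hτ (fun g _ => by simp) (fun g _ => by simp) ?_
    intro g _
    have hiff : A.map (Equiv.swap p.1 p.2).toEmbedding =
        (secondRow (tabloid t)).map g.toEmbedding ↔
        A = (secondRow (tabloid t)).map (Equiv.swap p.1 p.2 * g).toEmbedding := by
      have e1 : (secondRow (tabloid t)).map (Equiv.swap p.1 p.2 * g).toEmbedding =
          ((secondRow (tabloid t)).map g.toEmbedding).map (Equiv.swap p.1 p.2).toEmbedding := by
        rw [Finset.map_map]
        rfl
      rw [e1]
      have e2 := fun B : Finset (Fin n) => map_inv_map (Equiv.swap p.1 p.2) B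
      rw [Equiv.swap_inv] at e2
      exact ⟨fun h => by rw [← h, e2], fun h => by rw [h, e2]⟩
    simp only [hiff]
    split_ifs
    · rw [Equiv.Perm.sign_mul, Equiv.Perm.sign_swap hpp]
      simp
    · simp
  · intro A hA x hx
    rcases hne A hA with h | h
    · obtain ⟨g, hg, rfl⟩ := exists_of_powersetSum_polytabloid_ne_zero h
      rw [hmem] at hx
      apply mem_pairElems_columnPairs
      rw [← hcol g hg]
      exact colOf_lt_of_rowOf hx
    · exact mem_pairElems_of_pairFun_ne_zero h hx
  · intro A hA p hp
    rcases hne A hA with h | h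
    · obtain ⟨g, hg, rfl⟩ := exists_of_powersetSum_polytabloid_ne_zero h
      obtain ⟨hp1, hp2, hp3⟩ := mem_columnPairs.1 hp
      have hpp : p.1 ≠ p.2 := fun h => by rw [h] at hp1; omega
      rw [hmem, hmem]
      have hrow : rowOf t (g.symm p.1) ≠ rowOf t (g.symm p.2) := fun h =>
        hpp (g.symm.injective (eq_of_rowOf_of_colOf t h (by rw [hcol g hg, hcol g hg, hp3])))
      rcases rowOf_twoRow t (g.symm p.1) with h1 | h1 <;>
        rcases rowOf_twoRow t (g.symm p.2) with h2 | h2 <;> simp_all [Xor]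
    · exact xor_of_pairFun_ne_zero hL h hp
  · rw [Pi.sub_apply, pairFun_firsts hL, firsts_columnPairs, powersetSum_polytabloid_apply,
      Finset.sum_eq_single 1]
    · have : secondRow (tabloid t) =
          (secondRow (tabloid t)).map (1 : Equiv.Perm (Fin n)).toEmbedding := by
        ext x; exact (Finset.mem_map_equiv (f := (1 : Equiv.Perm (Fin n)))).symm
      rw [if_pos this]
      simp
    -- A permutation that preserves every column and the second row fixes every entry, so only the
    -- identity contributes to the coefficient of the second row.
    · intro g hg hg1
      refine if_neg fun h => hg1 ?_
      ext x
      refine congrArg Fin.val (eq_of_rowOf_of_colOf t ?_ (mem_colStabilizer.1 hg x))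
      have h1 := Finset.ext_iff.1 h (g x)
      rw [hmem, mem_secondRow, Equiv.symm_apply_apply] at h1
      change rowOf t (g x) = 1 ↔ _ at h1
      change rowOf t (g x) = 1 ↔ rowOf t x = 1 at h1
      have h2 := rowOf_twoRow t (g x)
      have h3 := rowOf_twoRow t x
      change rowOf t (g x) = rowOf t x
      omega
    · intro h
      exact absurd (mem_colStabilizer.2 fun x => rfl) h

theorem card_twoRow_cells {a b : ℕ} {h : b ≤ a} : (twoRow a b h).cells.card = a + b := by
  have : (twoRow a b h).cells = (Finset.range a).image (Prod.mk 0) ∪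
      (Finset.range b).image (Prod.mk 1) := by
    ext ⟨i, j⟩
    rw [mem_twoRow]
    simp only [Finset.mem_union, Finset.mem_image, Finset.mem_range, Prod.mk.injEq]
    constructor
    · rintro (⟨rfl, h⟩ | ⟨rfl, h⟩)
      · exact Or.inl ⟨j, h, rfl, rfl⟩
      · exact Or.inr ⟨j, h, rfl, rfl⟩
    · rintro (⟨_, h, rfl, rfl⟩ | ⟨_, h, rfl, rfl⟩)
      · exact Or.inl ⟨rfl, h⟩
      · exact Or.inr ⟨rfl, h⟩
  rw [this, Finset.card_union_of_disjoint,
    Finset.card_image_of_injective _ (Prod.mk_right_injective 0),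
    Finset.card_image_of_injective _ (Prod.mk_right_injective 1), Finset.card_range,
    Finset.card_range]
  rw [Finset.disjoint_left]
  rintro ⟨i, j⟩ h1 h2
  simp only [Finset.mem_image, Finset.mem_range, Prod.mk.injEq] at h1 h2
  obtain ⟨_, _, rfl, _⟩ := h1
  obtain ⟨_, _, h, _⟩ := h2
  omega

/-- The pairs of `L` fill the columns of length two injectively, and any extension to a bijection
fills the rest of the first row. -/
theorem exists_columnPairs_eq (hk : k ≤ n - k) {L : List (Fin n × Fin n)}
    (hL : (pairElems L).Nodup) (hlen : L.length = k) :
    ∃ t : Tableau (twoRow (n - k) k hk) n, columnPairs t = L := by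
  subst hlen
  obtain ⟨h1, h2⟩ := List.nodup_flatMap.1 hL
  rw [List.pairwise_iff_get] at h2
  have hne : ∀ i j : Fin L.length, (L.get i).1 ≠ (L.get j).2 ∧
      ((L.get i).1 = (L.get j).1 → i = j) ∧ ((L.get i).2 = (L.get j).2 → i = j) := by
    intro i j
    rcases lt_trichotomy i j with h | rfl | h
    · have := h2 i j h
      simp only [Function.onFun, List.disjoint_left, List.mem_cons, List.not_mem_nil,
        or_false] at this
      refine ⟨fun h => this (Or.inl rfl) (Or.inr h), fun h => ?_, fun h => ?_⟩
      · exact absurd (Or.inl h) (this (Or.inl rfl))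
      · exact absurd (Or.inr h) (this (Or.inr rfl))
    · have := h1 _ (List.get_mem L i)
      simp only [List.nodup_cons, List.mem_singleton] at this
      exact ⟨this.1, fun _ => rfl, fun _ => rfl⟩
    · have := h2 j i h
      simp only [Function.onFun, List.disjoint_left, List.mem_cons, List.not_mem_nil,
        or_false] at this
      refine ⟨fun h => this (Or.inr rfl) (Or.inl h.symm), fun h => ?_, fun h => ?_⟩
      · exact absurd (Or.inl h.symm) (this (Or.inl rfl))
      · exact absurd (Or.inr h.symm) (this (Or.inr rfl))
  classical
  rcases Nat.eq_zero_or_pos L.length with h0 | hpos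
  · have e : Fintype.card (twoRow (n - L.length) L.length hk).cells = Fintype.card (Fin n) := by
      rw [Fintype.card_coe, card_twoRow_cells, Fintype.card_fin]
      omega
    refine ⟨Fintype.equivOfCardEq e, ?_⟩
    exact (List.length_eq_zero_iff.1 ((length_columnPairs _).trans h0)).trans
      (List.length_eq_zero_iff.1 h0).symm
  -- The remainder only makes `f` total: the values in columns beyond the pairs are discarded by the
  -- extension. It needs `L` nonempty, hence the separate case above.
  let f : (twoRow (n - L.length) L.length hk).cells → Fin n := fun c =>
    let p := L.get ⟨c.1.2 % L.length, Nat.mod_lt _ hpos⟩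
    if c.1.1 = 1 then p.1 else p.2
  obtain ⟨g, hg⟩ := Set.MapsTo.exists_equiv_extend_of_card_eq (t := (Finset.univ : Finset (Fin n)))
    (α := (twoRow (n - L.length) L.length hk).cells)
    (s := {c | c.1.2 < L.length}) (f := f)
    (by rw [Fintype.card_coe, card_twoRow_cells, Finset.card_univ, Fintype.card_fin]; omega)
    (by intro c _; simp) (by
      rintro ⟨⟨i, j⟩, hc⟩ hj ⟨⟨i', j'⟩, hc'⟩ hj' h
      simp only [Set.mem_ofPred_eq] at hj hj'
      simp only [f] at h
      have hi := mem_twoRow.1 hc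
      have hi' := mem_twoRow.1 hc'
      simp only at hi hi'
      have hjj : (⟨j % L.length, Nat.mod_lt _ hpos⟩ : Fin L.length) =
          ⟨j' % L.length, Nat.mod_lt _ hpos⟩ → j = j' := by
        intro h
        have := congrArg Fin.val h
        simpa [Nat.mod_eq_of_lt hj, Nat.mod_eq_of_lt hj'] using this
      split_ifs at h with h3 h4 h4
      · obtain rfl := hjj ((hne _ _).2.1 h)
        simp [h3, h4]
      · exact absurd h (hne _ _).1
      · exact absurd h.symm (hne _ _).1
      · obtain rfl := hjj ((hne _ _).2.2 h)
        have : i = i' := by omega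
        simp [this])
  refine ⟨g.trans ⟨Subtype.val, fun x => ⟨x, Finset.mem_univ x⟩, fun _ => rfl, fun _ => rfl⟩, ?_⟩
  rw [columnPairs]
  conv_rhs => rw [← List.ofFn_get L]
  congr 1
  ext1 i
  refine Prod.ext ?_ ?_
  · refine (hg ⟨(1, i), _⟩ i.2).trans ?_
    simp [f, Nat.mod_eq_of_lt i.2]
  · refine (hg ⟨(0, i), _⟩ i.2).trans ?_
    simp [f, Nat.mod_eq_of_lt i.2]

theorem map_powersetSum_specht (hk : k ≤ n - k) :
    (Specht (twoRow (n - k) k hk) n).map (powersetSum secondRow) =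
      Submodule.span ℂ (pairFuns (Finset.univ : Finset (Fin n)) k) := by
  rw [Specht, Submodule.map_span]
  congr 1
  ext f
  constructor
  · rintro ⟨_, ⟨t, rfl⟩, rfl⟩
    exact ⟨columnPairs t, nodup_columnPairs t, length_columnPairs t, fun x _ => Finset.mem_univ x,
      powersetSum_polytabloid t⟩
  · rintro ⟨L, h1, h2, -, rfl⟩
    obtain ⟨t, rfl⟩ := exists_columnPairs_eq hk h1 h2
    exact ⟨_, ⟨t, rfl⟩, powersetSum_polytabloid t⟩

theorem ker_lower (hk : k ≤ n - k) {f : Finset (Fin n) → ℂ} :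
    ((∀ A, f A ≠ 0 → A.card = k) ∧ lower Finset.univ f = 0) ↔
      ∃ v ∈ Specht (twoRow (n - k) k hk) n, powersetSum secondRow v = f := by
  have : f ∈ (Specht (twoRow (n - k) k hk) n).map (powersetSum secondRow) ↔ _ := Submodule.mem_map
  rw [← this, map_powersetSum_specht]
  constructor
  · rintro ⟨h1, h2⟩
    exact mem_span_pairFuns _ _ _ (fun A hA => ⟨Finset.subset_univ A, h1 A hA⟩) h2
  · intro h
    obtain ⟨h1, h2⟩ := span_pairFuns_le _ _ h
    exact ⟨fun A hA => (h1 A hA).2, h2⟩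

/-- The multiplicity of a two-row Specht module as a difference of the multiplicities of two
permutation modules on subsets. -/
theorem multiplicity_spechtRep (hk : k ≤ n - k) {W : Type*} [AddCommGroup W] [Module ℂ W]
    [FiniteDimensional ℂ W] (ρ : Representation ℂ (Equiv.Perm (Fin n)) W) :
    multiplicity (spechtRep (twoRow (n - k) k hk) n) ρ +
      multiplicity (Representation.ofMulAction ℂ (Equiv.Perm (Fin n)) (SubsetsOfCard n k 1)) ρ =
    multiplicity (Representation.ofMulAction ℂ (Equiv.Perm (Fin n)) (SubsetsOfCard n k 0)) ρ := by
  have hinj₁ : Function.Injective (powersetSum (Subtype.val : SubsetsOfCard n k 1 → _)) :=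
    powersetSum_injective Subtype.val_injective
  have hcard₁ : ∀ h : ℂ[SubsetsOfCard n k 1], ∀ A,
      raise Finset.univ (powersetSum Subtype.val h) A ≠ 0 → A.card + 0 = k := fun h A hA =>
    by_contra fun hne => hA (raise_eq_zero_of_card (fun A hA => card_of_powersetSum_ne_zero hA) hne)
  have hspecht : ∀ v : Specht (twoRow (n - k) k hk) n,
      (∀ A, powersetSum secondRow v.1 A ≠ 0 → A.card = k) ∧
        lower Finset.univ (powersetSum secondRow v.1) = 0 := fun v =>
    (ker_lower hk).2 ⟨v.1, v.2, rfl⟩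
  have hraise : ∀ h : ℂ[SubsetsOfCard n k 1],
      raise Finset.univ (powersetSum Subtype.val h) = 0 → h = 0 := by
    intro h hh
    apply hinj₁
    rw [map_zero]
    -- For `k = 0` there are no subsets with `#A + 1 = k`, so the second module is zero. Otherwise
    -- the level is `k - 1`, below the middle.
    rcases Nat.eq_zero_or_pos k with rfl | hpos
    · ext A
      by_contra h0
      have := card_of_powersetSum_ne_zero h0
      omega
    · refine eq_zero_of_raise_eq_zero Finset.univ (k - 1) ?_ _ (fun A hA => ?_) hh
      · rw [Finset.card_univ, Fintype.card_fin]; omega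
      · have := card_of_powersetSum_ne_zero hA
        exact ⟨Finset.subset_univ A, by omega⟩
  have hlower : ∀ h : ℂ[SubsetsOfCard n k 1],
      lower Finset.univ (raise Finset.univ (powersetSum Subtype.val h)) = 0 → h = 0 := fun h hh =>
    hraise h (raise_eq_zero_of_lower_raise_eq_zero _ _ hh)
  let a : Representation.IntertwiningMap (spechtRep (twoRow (n - k) k hk) n)
      (Representation.ofMulAction ℂ (Equiv.Perm (Fin n)) (SubsetsOfCard n k 0)) :=
    LinearMap.intertwiningMap_of_isIntertwiningMap _ _
      (restrictCard n k 0 ∘ₗ powersetSum secondRow ∘ₗ (Specht (twoRow (n - k) k hk) n).subtype)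
      (fun g v => by
        rw [LinearMap.comp_apply, LinearMap.comp_apply, LinearMap.comp_apply, LinearMap.comp_apply,
          ← restrictCard_permFun]
        congr 1
        exact powersetSum_ofMulAction secondRow_smul g v.1)
  let b : Representation.IntertwiningMap
      (Representation.ofMulAction ℂ (Equiv.Perm (Fin n)) (SubsetsOfCard n k 1))
      (Representation.ofMulAction ℂ (Equiv.Perm (Fin n)) (SubsetsOfCard n k 0)) :=
    LinearMap.intertwiningMap_of_isIntertwiningMap _ _
      (restrictCard n k 0 ∘ₗ raise Finset.univ ∘ₗ powersetSum Subtype.val)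
      (fun g v => by
        rw [LinearMap.comp_apply, LinearMap.comp_apply, LinearMap.comp_apply, LinearMap.comp_apply,
          ← restrictCard_permFun, powersetSum_ofMulAction coe_smul_subset, raise_permFun])
  -- Read in the Boolean lattice, the map is `(v, h) ↦ v + raise h`. Lowering kills `v`, and `lower
  -- ∘ raise` is injective on `h`, so the map is injective.
  have key : ∀ v h, powersetSum Subtype.val (a.toLinearMap.coprod b.toLinearMap (v, h)) =
      powersetSum secondRow v.1 + raise Finset.univ (powersetSum Subtype.val h) := by
    intro v h
    rw [LinearMap.coprod_apply, map_add]
    congr 1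
    · exact powersetSum_restrictCard k 0 _ (hspecht v).1
    · exact powersetSum_restrictCard k 0 _ (hcard₁ h)
  refine multiplicity_add_of_bijective ρ a b ⟨?_, ?_⟩
  · rw [injective_iff_map_eq_zero]
    rintro ⟨v, h⟩ hvh
    have h1 := key v h
    rw [hvh, map_zero] at h1
    have h2 : h = 0 := by
      apply hlower
      have := congrArg (lower Finset.univ) h1
      rwa [map_zero, map_add, (hspecht v).2, zero_add, eq_comm] at this
    subst h2
    rw [map_zero, map_zero, add_zero] at h1
    have h3 : v = 0 := Subtype.ext (powersetSum_injective secondRow_injective (by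
      rw [← h1]; exact (map_zero _).symm))
    rw [h3]
    rfl
  · intro u
    -- On the finite-dimensional level `k - 1` the injective map `lower ∘ raise` is also surjective.
    -- Solving `lower (raise h) = lower u` leaves `u - raise h` in the kernel of lowering, which is
    -- the Specht module.
    let E : ℂ[SubsetsOfCard n k 1] →ₗ[ℂ] ℂ[SubsetsOfCard n k 1] :=
      restrictCard n k 1 ∘ₗ lower Finset.univ ∘ₗ raise Finset.univ ∘ₗ powersetSum Subtype.val
    have hlc : ∀ f : Finset (Fin n) → ℂ, (∀ A, f A ≠ 0 → A.card + 0 = k) →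
        powersetSum Subtype.val (restrictCard n k 1 (lower Finset.univ f)) = lower Finset.univ f :=
      fun f hf => powersetSum_restrictCard k 1 _ fun A hA =>
        by_contra fun hne => hA (lower_eq_zero_of_card hf hne)
    have hE : Function.Injective E := by
      rw [injective_iff_map_eq_zero]
      intro h hh
      apply hlower
      rw [← hlc _ (hcard₁ h)]
      change powersetSum Subtype.val (E h) = 0
      rw [hh, map_zero]
    have hu : ∀ A, powersetSum Subtype.val u A ≠ 0 → A.card + 0 = k := fun A hA =>
      card_of_powersetSum_ne_zero hA
    obtain ⟨h, hh⟩ := LinearMap.injective_iff_surjective.1 hE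
      (restrictCard n k 1 (lower Finset.univ (powersetSum Subtype.val u)))
    have h1 : lower Finset.univ (raise Finset.univ (powersetSum Subtype.val h)) =
        lower Finset.univ (powersetSum Subtype.val u) := by
      rw [← hlc _ (hcard₁ h), ← hlc _ hu, ← hh]
      rfl
    obtain ⟨v, hv, hvu⟩ := (ker_lower hk
      (f := powersetSum Subtype.val u - raise Finset.univ (powersetSum Subtype.val h))).1
      ⟨fun A hA => by
        by_cases h0 : powersetSum Subtype.val u A = 0
        · exact hcard₁ h A fun h' => hA (by rw [Pi.sub_apply, h0, h', sub_zero])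
        · exact hu A h0, by rw [map_sub, h1, sub_self]⟩
    refine ⟨(⟨v, hv⟩, h), powersetSum_injective Subtype.val_injective ?_⟩
    rw [key, hvu, sub_add_cancel]

end SpechtTwoRow

/-! ### Weighted sums of maps between bases. -/

section FaceSum

variable {Y Z Y' Z' : Type*} {m : ℕ}

/-- The linear map on formal sums `y ↦ ∑ l, ε l • d l y`. -/
def faceSum (d : Fin m → Y → Z) (ε : Fin m → ℂ) : (Y →₀ ℂ) →ₗ[ℂ] (Z →₀ ℂ) :=
  ∑ l, ε l • Finsupp.lmapDomain ℂ ℂ (d l)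

theorem faceSum_apply (d : Fin m → Y → Z) (ε : Fin m → ℂ) (v : Y →₀ ℂ) :
    faceSum d ε v = ∑ l, ε l • Finsupp.mapDomain (d l) v := by
  simp [faceSum]

theorem faceSum_mapDomain {d : Fin m → Y → Z} {d' : Fin m → Y' → Z'} {f : Y → Y'} {g : Z → Z'}
    (h : ∀ l y, d' l (f y) = g (d l y)) (ε : Fin m → ℂ) (v : Y →₀ ℂ) :
    faceSum d' ε (Finsupp.mapDomain f v) = Finsupp.mapDomain g (faceSum d ε v) := by
  have hg := map_sum (Finsupp.lmapDomain ℂ ℂ g) (fun l => ε l • Finsupp.mapDomain (d l) v)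
    Finset.univ
  rw [faceSum_apply, faceSum_apply]
  refine Eq.trans ?_ hg.symm
  refine Finset.sum_congr rfl fun l _ => ?_
  rw [map_smul, Finsupp.lmapDomain_apply, ← Finsupp.mapDomain_comp, ← Finsupp.mapDomain_comp]
  congr 2
  exact funext fun y => h l y

/-- Basis elements of the target outside the image of `g` do not affect the kernel, so injectivity
of `g` suffices. -/
theorem finrank_ker_faceSum_congr {d : Fin m → Y → Z} {d' : Fin m → Y' → Z'} (e : Y ≃ Y')
    {g : Z → Z'} (hg : Function.Injective g) (h : ∀ l y, d' l (e y) = g (d l y)) (ε : Fin m → ℂ) :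
    Module.finrank ℂ (LinearMap.ker (faceSum d ε)) =
      Module.finrank ℂ (LinearMap.ker (faceSum d' ε)) := by
  have hmap : LinearMap.ker (faceSum d' ε) =
      (LinearMap.ker (faceSum d ε)).map (Finsupp.domLCongr e : (Y →₀ ℂ) ≃ₗ[ℂ] _).toLinearMap := by
    have key : ∀ v : Y →₀ ℂ, faceSum d' ε ((Finsupp.domLCongr e : (Y →₀ ℂ) ≃ₗ[ℂ] _) v) =
        Finsupp.mapDomain g (faceSum d ε v) := by
      intro v
      rw [← faceSum_mapDomain h, Finsupp.domLCongr_apply, Finsupp.domCongr_apply,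
        Finsupp.equivMapDomain_eq_mapDomain]
    ext v
    rw [Submodule.mem_map]
    constructor
    · intro hv
      refine ⟨(Finsupp.domLCongr e : (Y →₀ ℂ) ≃ₗ[ℂ] _).symm v, ?_, LinearEquiv.apply_symm_apply _ _⟩
      rw [LinearMap.mem_ker] at hv ⊢
      apply Finsupp.mapDomain_injective hg
      rw [← key, LinearEquiv.apply_symm_apply, hv, Finsupp.mapDomain_zero]
    · rintro ⟨w, hw, rfl⟩
      rw [LinearMap.mem_ker] at hw ⊢
      rw [LinearEquiv.coe_coe, key, hw, Finsupp.mapDomain_zero]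
  rw [hmap]
  exact (LinearEquiv.finrank_map_eq _ _).symm

theorem mapDomain_eq_sum [Fintype Y] [DecidableEq Z] (f : Y → Z) (v : Y →₀ ℂ) (z : Z) :
    Finsupp.mapDomain f v z = ∑ y, if f y = z then v y else 0 := by
  rw [Finsupp.mapDomain, Finsupp.sum_fintype _ _ (by simp), Finsupp.finsetSum_apply]
  exact Finset.sum_congr rfl fun y _ => Finsupp.single_apply

end FaceSum

/-! ### Intertwining maps from a permutation module, computed on orbits. -/

section Orbits

variable {G X Y Z : Type*} [Group G] [MulAction G X] [MulAction G Y] [MulAction G Z]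
  {m : ℕ} {d : Fin m → Y → Z}

/-- The orbit of a pair. -/
def orbitMk (G : Type*) {X Y : Type*} [Group G] [MulAction G X] [MulAction G Y] (x : X) (y : Y) :
    MulAction.orbitRel.Quotient G (X × Y) := Quotient.mk _ (x, y)

theorem orbitMk_eq_iff {x x' : X} {y y' : Y} :
    orbitMk G x y = orbitMk G x' y' ↔ ∃ g : G, g • x' = x ∧ g • y' = y := by
  rw [orbitMk, orbitMk, Quotient.eq, MulAction.orbitRel_apply, MulAction.mem_orbit_iff]
  simp [Prod.ext_iff]

theorem orbitMk_smul (g : G) (x : X) (y : Y) : orbitMk G (g • x) (g • y) = orbitMk G x y :=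
  orbitMk_eq_iff.2 ⟨g, rfl, rfl⟩

/-- The map on orbits of pairs that is induced by an equivariant map in the second component. -/
def orbitFace (G X : Type*) {Y Z : Type*} [Group G] [MulAction G X] [MulAction G Y]
    [MulAction G Z] {m : ℕ} (d : Fin m → Y → Z) (hd : ∀ l (g : G) y, d l (g • y) = g • d l y)
    (l : Fin m) :
    MulAction.orbitRel.Quotient G (X × Y) → MulAction.orbitRel.Quotient G (X × Z) :=
  Quotient.map (Prod.map id (d l)) (by
    rintro ⟨x, y⟩ ⟨x', y'⟩ ⟨g, hg⟩
    obtain ⟨rfl, rfl⟩ := Prod.ext_iff.1 hg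
    exact ⟨g, Prod.ext rfl (hd l g _).symm⟩)

theorem orbitFace_mk (hd : ∀ l (g : G) y, d l (g • y) = g • d l y) (l : Fin m) (x : X) (y : Y) :
    orbitFace G X d hd l (orbitMk G x y) = orbitMk G x (d l y) := rfl

/-- The formal sum of orbits of a family of formal sums. -/
def orbitSum (G : Type*) {X Y : Type*} [Group G] [MulAction G X] [MulAction G Y] [Fintype X] :
    (X → (Y →₀ ℂ)) →ₗ[ℂ] (MulAction.orbitRel.Quotient G (X × Y) →₀ ℂ) :=
  ∑ x, Finsupp.lmapDomain ℂ ℂ (orbitMk G x) ∘ₗ LinearMap.proj x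

/-- A family of formal sums that is invariant under a group. -/
def InvariantFamily (G : Type*) {X Y : Type*} [Group G] [MulAction G X] [MulAction G Y]
    (u : X → (Y →₀ ℂ)) : Prop :=
  ∀ (g : G) x y, u (g • x) (g • y) = u x y

theorem InvariantFamily.eq_of_orbitMk_eq {u : X → (Y →₀ ℂ)} (hu : InvariantFamily G u)
    {x x' : X} {y y' : Y} (h : orbitMk G x y = orbitMk G x' y') : u x y = u x' y' := by
  obtain ⟨g, rfl, rfl⟩ := orbitMk_eq_iff.1 h
  exact hu g x' y'

variable [Fintype X]

theorem orbitSum_apply (u : X → (Y →₀ ℂ)) :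
    orbitSum G u = ∑ x, Finsupp.mapDomain (orbitMk G x) (u x) := by
  simp [orbitSum]

theorem faceSum_orbitSum (hd : ∀ l (g : G) y, d l (g • y) = g • d l y) (ε : Fin m → ℂ)
    (u : X → (Y →₀ ℂ)) :
    faceSum (orbitFace G X d hd) ε (orbitSum G u) = orbitSum G fun x => faceSum d ε (u x) := by
  rw [orbitSum_apply, orbitSum_apply, map_sum]
  exact Finset.sum_congr rfl fun x _ => faceSum_mapDomain (fun l y => orbitFace_mk hd l x y) ε (u x)

variable [Fintype Y]

open Classical in
theorem orbitSum_eq_sum (u : X → (Y →₀ ℂ)) (q : MulAction.orbitRel.Quotient G (X × Y)) :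
    orbitSum G u q =
      ∑ w ∈ Finset.univ.filter (fun w : X × Y => orbitMk G w.1 w.2 = q), u w.1 w.2 := by
  rw [orbitSum_apply, Finsupp.finsetSum_apply, Finset.sum_filter, Fintype.sum_prod_type]
  exact Finset.sum_congr rfl fun x _ => mapDomain_eq_sum _ _ _

/-- On an invariant family, the coefficient of `orbitSum` at an orbit is the common value there
times the size of the orbit, which is nonzero in `ℂ`. -/
theorem eq_zero_of_orbitSum_eq_zero {u : X → (Y →₀ ℂ)} (hu : InvariantFamily G u)
    (h : orbitSum G u = 0) : u = 0 := by
  classical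
  ext x y
  have h1 := orbitSum_eq_sum u (orbitMk G x y)
  rw [h, Finset.sum_congr rfl (g := fun _ => u x y) fun w hw =>
    hu.eq_of_orbitMk_eq (Finset.mem_filter.1 hw).2, Finset.sum_const, nsmul_eq_mul] at h1
  have h2 : (Finset.univ.filter fun w : X × Y => orbitMk G w.1 w.2 = orbitMk G x y).card ≠ 0 :=
    (Finset.card_pos.2 ⟨(x, y), by simp⟩).ne'
  have h3 := mul_eq_zero.1 h1.symm
  exact h3.resolve_left (by exact_mod_cast h2)

theorem exists_invariantFamily (h : MulAction.orbitRel.Quotient G (X × Y) →₀ ℂ) :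
    ∃ u : X → (Y →₀ ℂ), InvariantFamily G u ∧ orbitSum G u = h := by
  classical
  -- The size of an orbit; dividing by it compensates for the repeated summands.
  let c : MulAction.orbitRel.Quotient G (X × Y) → ℕ := fun q =>
    (Finset.univ.filter fun w : X × Y => orbitMk G w.1 w.2 = q).card
  refine ⟨fun x => Finsupp.equivFunOnFinite.symm fun y => h (orbitMk G x y) / c (orbitMk G x y),
    fun g x y => ?_, ?_⟩
  · simp [orbitMk_smul]
  · ext q
    rw [orbitSum_eq_sum, Finset.sum_congr rfl (g := fun _ => h q / c q) fun w hw => by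
      simp [(Finset.mem_filter.1 hw).2], Finset.sum_const, nsmul_eq_mul]
    obtain ⟨⟨x, y⟩, rfl⟩ := Quotient.exists_rep q
    have h2 : c (orbitMk G x y) ≠ 0 := (Finset.card_pos.2 ⟨(x, y), by simp⟩).ne'
    exact mul_div_cancel₀ _ (by exact_mod_cast h2)

theorem InvariantFamily.faceSum {X : Type*} [MulAction G X] [Fintype Z]
    (hd : ∀ l (g : G) y, d l (g • y) = g • d l y)
    (ε : Fin m → ℂ) {u : X → (Y →₀ ℂ)} (hu : InvariantFamily G u) :
    InvariantFamily G fun x => faceSum d ε (u x) := by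
  classical
  intro g x z
  simp only [faceSum_apply, Finsupp.finsetSum_apply, Finsupp.smul_apply, mapDomain_eq_sum]
  refine Finset.sum_congr rfl fun l _ => ?_
  congr 1
  refine (Equiv.sum_comp (MulAction.toPerm g) _).symm.trans (Finset.sum_congr rfl fun y _ => ?_)
  simp [hd, hu g x y]

variable [Fintype Z]

/-- Let `ρ` be the representation on the kernel of an equivariant map `faceSum d ε` of permutation
representations. The multiplicity of a permutation representation in `ρ` is the dimension of the
kernel of the induced map on orbits. -/
theorem multiplicity_ofMulAction (hd : ∀ l (g : G) y, d l (g • y) = g • d l y) (ε : Fin m → ℂ)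
    {V : Type*} [AddCommGroup V] [Module ℂ V] (ρ : Representation ℂ G V)
    (a : Representation.IntertwiningMap ρ (Representation.ofMulAction ℂ G Y))
    (ha : Function.Injective a) (hr : ∀ v : Y →₀ ℂ, faceSum d ε v = 0 ↔ ∃ w, (a w).coeff = v) :
    multiplicity (Representation.ofMulAction ℂ G X) ρ =
      Module.finrank ℂ (LinearMap.ker (faceSum (orbitFace G X d hd) ε)) := by
  -- An intertwining map is recorded by its values on the basis `X`, a family invariant under `G`.
  let fam : Representation.IntertwiningMap (Representation.ofMulAction ℂ G X) ρ →ₗ[ℂ]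
      (X → (Y →₀ ℂ)) :=
    { toFun := fun φ x => (a (φ (MonoidAlgebra.single x 1))).coeff
      map_add' := fun φ ψ => by
        ext x y
        change (a (φ _ + ψ _)).coeff y = _
        rw [map_add]
        rfl
      map_smul' := fun c φ => by
        ext x y
        change (a (c • φ _)).coeff y = _
        rw [map_smul]
        rfl }
  have hfam : ∀ φ x, fam φ x = (a (φ (MonoidAlgebra.single x 1))).coeff := fun _ _ => rfl
  have hinv : ∀ φ, InvariantFamily G (fam φ) := by
    intro φ g x y
    rw [hfam, hfam]
    have : (MonoidAlgebra.single (g • x) (1 : ℂ)) =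
        Representation.ofMulAction ℂ G X g (MonoidAlgebra.single x 1) :=
      (Representation.ofMulAction_single g x 1).symm
    rw [this, φ.isIntertwining, a.isIntertwining, Representation.coeff_ofMulAction,
      inv_smul_smul]
  have hinj : Function.Injective (orbitSum G ∘ₗ fam) := by
    rw [injective_iff_map_eq_zero]
    intro φ hφ
    have h0 := eq_zero_of_orbitSum_eq_zero (hinv φ) hφ
    ext x
    have h1 : (a (φ (MonoidAlgebra.single x 1))).coeff = 0 := congrFun h0 x
    rw [MonoidAlgebra.coeff_eq_zero] at h1
    exact ha (h1.trans (map_zero a).symm)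
  have hrange : LinearMap.range (orbitSum G ∘ₗ fam) =
      LinearMap.ker (faceSum (orbitFace G X d hd) ε) := by
    ext h
    rw [LinearMap.mem_range, LinearMap.mem_ker]
    constructor
    · rintro ⟨φ, rfl⟩
      rw [LinearMap.comp_apply, faceSum_orbitSum hd]
      have : (fun x => faceSum d ε (fam φ x)) = 0 := funext fun x => (hr _).2 ⟨_, rfl⟩
      rw [this, map_zero]
    · intro hh
      obtain ⟨u, hu, rfl⟩ := exists_invariantFamily h
      rw [faceSum_orbitSum hd] at hh
      -- The images of the family form an invariant family with zero orbit sum, so each `u x` lies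
      -- in the kernel and comes from a vector of `V`.
      have h0 := eq_zero_of_orbitSum_eq_zero (hu.faceSum hd ε) hh
      choose v hv using fun x => (hr (u x)).1 (congrFun h0 x)
      let φ : ℂ[X] →ₗ[ℂ] V := Finsupp.linearCombination ℂ v ∘ₗ
        (MonoidAlgebra.coeffLinearEquiv ℂ).toLinearMap
      have hφ : ∀ x, φ (MonoidAlgebra.single x 1) = v x := fun x => by simp [φ]
      have hvg : ∀ (g : G) x, v (g • x) = ρ g (v x) := by
        intro g x
        apply ha
        rw [a.isIntertwining]
        ext y
        rw [Representation.coeff_ofMulAction, hv, hv, ← hu g x, smul_inv_smul]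
      refine ⟨LinearMap.intertwiningMap_of_isIntertwiningMap _ _ φ fun g w => ?_, ?_⟩
      · suffices h : φ ∘ₗ Representation.ofMulAction ℂ G X g = ρ g ∘ₗ φ from
          LinearMap.congr_fun h w
        ext x
        simp only [LinearMap.comp_apply, MonoidAlgebra.lsingle_apply,
          Representation.ofMulAction_single, hφ, hvg]
      · rw [LinearMap.comp_apply]
        congr 1
        ext1 x
        rw [hfam, ← hv x, ← hφ x]
        rfl
  rw [multiplicity, ← LinearMap.finrank_range_of_inj hinj, hrange]

end Orbits

/-! ### Adding and detecting singleton blocks. -/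

section Singletons

variable {n : ℕ}

theorem permute_eq_iff {g : Equiv.Perm (Fin n)} {p q : Setoid (Fin n)} :
    permute g p = q ↔ ∀ x y, q (g x) (g y) ↔ p x y := by
  constructor
  · rintro rfl x y
    simp [permute_rel]
  · intro h
    ext x y
    rw [permute_rel, ← h]
    simp

/-- The set partition obtained by adding the singleton block `{0}` to a set partition of the
positive elements of `Fin (n + 1)`. -/
def addSingleton (p : Setoid (Fin n)) : Setoid (Fin (n + 1)) where
  r x y := x = y ∨ ∃ a b, Fin.succ a = x ∧ Fin.succ b = y ∧ p a b
  iseqv :=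
    { refl := fun _ => Or.inl rfl
      symm := by
        rintro x y (rfl | ⟨a, b, rfl, rfl, h⟩)
        · exact Or.inl rfl
        · exact Or.inr ⟨b, a, rfl, rfl, p.symm h⟩
      trans := by
        rintro x y z (rfl | ⟨a, b, rfl, rfl, h⟩) (rfl | ⟨a', b', h1, rfl, h'⟩)
        · exact Or.inl rfl
        · exact Or.inr ⟨a', b', h1, rfl, h'⟩
        · exact Or.inr ⟨a, b, rfl, rfl, h⟩
        · obtain rfl := Fin.succ_injective _ h1
          exact Or.inr ⟨a, b', rfl, rfl, p.trans h h'⟩ }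

theorem addSingleton_rel {p : Setoid (Fin n)} {x y : Fin (n + 1)} :
    addSingleton p x y ↔ x = y ∨ ∃ a b, Fin.succ a = x ∧ Fin.succ b = y ∧ p a b := Iff.rfl

theorem addSingleton_succ_succ {p : Setoid (Fin n)} {a b : Fin n} :
    addSingleton p a.succ b.succ ↔ p a b := by
  rw [addSingleton_rel]
  constructor
  · rintro (h | ⟨a', b', h1, h2, h⟩)
    · rw [Fin.succ_injective _ h]
    · rwa [← Fin.succ_injective _ h1, ← Fin.succ_injective _ h2]
  · exact fun h => Or.inr ⟨a, b, rfl, rfl, h⟩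

theorem addSingleton_zero {p : Setoid (Fin n)} {y : Fin (n + 1)} :
    addSingleton p 0 y ↔ y = 0 := by
  rw [addSingleton_rel]
  constructor
  · rintro (h | ⟨a, b, h, -⟩)
    · exact h.symm
    · exact absurd h (Fin.succ_ne_zero a)
  · exact fun h => Or.inl h.symm

theorem addSingleton_comap {q : Setoid (Fin (n + 1))} (hq : ∀ y, q 0 y → y = 0) :
    addSingleton (q.comap Fin.succ) = q := by
  ext x y
  refine Fin.cases ?_ (fun a => ?_) x
  · rw [addSingleton_zero]
    exact ⟨fun h => h ▸ q.refl 0, hq y⟩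
  · refine Fin.cases ?_ (fun b => ?_) y
    · constructor
      · intro h
        exact absurd (addSingleton_zero.1 ((addSingleton _).symm h)) (Fin.succ_ne_zero a)
      · intro h
        exact absurd (hq _ (q.symm h)) (Fin.succ_ne_zero a)
    · exact addSingleton_succ_succ

theorem addSingleton_le {p q : Setoid (Fin n)} : addSingleton p ≤ addSingleton q ↔ p ≤ q := by
  constructor
  · intro h a b hab
    exact addSingleton_succ_succ.1 (h (addSingleton_succ_succ.2 hab))
  · rintro h x y (rfl | ⟨a, b, rfl, rfl, hab⟩)
    · exact (addSingleton q).refl x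
    · exact addSingleton_succ_succ.2 (h hab)

theorem rank_addSingleton (p : Setoid (Fin n)) : rank (addSingleton p) = rank p := by
  let f : Option (Quotient p) → Quotient (addSingleton p) := fun o =>
    o.elim (Quotient.mk _ 0) (Quotient.map Fin.succ fun _ _ h => addSingleton_succ_succ.2 h)
  have hf : Function.Bijective f := by
    constructor
    · intro a b
      refine Option.rec ?_ (fun a => ?_) a <;> refine Option.rec ?_ (fun b => ?_) b
      · exact fun _ => rfl
      · refine Quotient.inductionOn b fun b h => ?_
        exact absurd (addSingleton_zero.1 (Quotient.exact h)) (Fin.succ_ne_zero b)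
      · refine Quotient.inductionOn a fun a h => ?_
        exact absurd (addSingleton_zero.1 (Quotient.exact h.symm)) (Fin.succ_ne_zero a)
      · refine Quotient.inductionOn₂ a b fun a b h => ?_
        exact congrArg some (Quotient.sound (addSingleton_succ_succ.1 (Quotient.exact h)))
    · intro q
      refine Quotient.inductionOn q fun x => ?_
      refine Fin.cases ⟨none, rfl⟩ (fun a => ⟨some (Quotient.mk _ a), rfl⟩) x
  rw [rank, rank, ← Nat.card_congr (Equiv.ofBijective f hf), Finite.card_option,
    Nat.add_sub_add_right]

/-- The number of elements outside the singleton blocks is at most twice the rank. -/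
theorem card_nonsingleton_le (p : Setoid (Fin n)) (T : Finset (Fin n))
    (hT : ∀ x ∈ T, ∃ y, p x y ∧ y ≠ x) : T.card ≤ 2 * rank p := by
  classical
  let T' : Finset (Fin n) := Finset.univ.filter fun x => ∃ y, p x y ∧ y ≠ x
  have hTT' : T.card ≤ T'.card := Finset.card_le_card fun x hx => by simpa [T'] using hT x hx
  let q : Fin n → Quotient p := Quotient.mk p
  -- Each block that meets `T'` has at least two elements, all in `T'`. Hence there are at most `#T'
  -- / 2 + (n - #T')` blocks, and the rank is at least `#T' / 2`.
  have h1 : 2 * (T'.image q).card ≤ T'.card := by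
    refine Finset.mul_card_image_le_card T' 2 fun b hb => ?_
    obtain ⟨x, hx, rfl⟩ := Finset.mem_image.1 hb
    obtain ⟨y, hxy, hne⟩ := (Finset.mem_filter.1 hx).2
    refine Finset.one_lt_card.2 ⟨x, by simp [hx], y, ?_, hne.symm⟩
    simp only [T', Finset.mem_filter, Finset.mem_univ, true_and]
    exact ⟨⟨x, p.symm hxy, hne.symm⟩, Quotient.sound (p.symm hxy)⟩
  have h2 : Nat.card (Quotient p) ≤ (T'.image q).card + T'ᶜ.card := by
    rw [Nat.card_eq_fintype_card, ← Finset.card_univ]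
    have : (Finset.univ : Finset (Quotient p)) ⊆ T'.image q ∪ T'ᶜ.image q := by
      intro b _
      obtain ⟨x, rfl⟩ := Quotient.exists_rep b
      by_cases hx : x ∈ T'
      · exact Finset.mem_union_left _ (Finset.mem_image_of_mem _ hx)
      · exact Finset.mem_union_right _ (Finset.mem_image_of_mem _ (Finset.mem_compl.2 hx))
    exact (Finset.card_le_card this).trans ((Finset.card_union_le _ _).trans
      (Nat.add_le_add_left Finset.card_image_le _))
  rw [Finset.card_compl, Fintype.card_fin] at h2
  have h3 : T'.card ≤ n := by simpa using Finset.card_le_univ T'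
  rw [rank]
  omega

/-- Adding a singleton block, as a map of rank-selected posets. -/
def addSingletonEmb (n : ℕ) (S : Finset ℕ) : RankSelected n S ↪o RankSelected (n + 1) S :=
  OrderEmbedding.ofMapLEIff
    (fun p => ⟨addSingleton p.1, by rw [rank_addSingleton]; exact p.2⟩)
    fun _ _ => addSingleton_le

/-- The extension of a permutation of the positive elements of `Fin (n + 1)`. -/
def extendPerm (g : Equiv.Perm (Fin n)) : Equiv.Perm (Fin (n + 1)) :=
  Equiv.Perm.decomposeFin.symm (0, g)

theorem extendPerm_zero (g : Equiv.Perm (Fin n)) : extendPerm g 0 = 0 :=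
  Equiv.Perm.decomposeFin_symm_apply_zero 0 g

theorem extendPerm_succ (g : Equiv.Perm (Fin n)) (x : Fin n) :
    extendPerm g x.succ = (g x).succ := by
  rw [extendPerm, Equiv.Perm.decomposeFin_symm_apply_succ, Equiv.swap_self]
  rfl

theorem exists_eq_extendPerm {h : Equiv.Perm (Fin (n + 1))} (h0 : h 0 = 0) :
    ∃ g, h = extendPerm g := by
  obtain ⟨⟨x, g⟩, rfl⟩ := Equiv.Perm.decomposeFin.symm.surjective h
  rw [Equiv.Perm.decomposeFin_symm_apply_zero] at h0
  subst h0
  exact ⟨g, rfl⟩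

theorem permute_extendPerm (g : Equiv.Perm (Fin n)) (p : Setoid (Fin n)) :
    permute (extendPerm g) (addSingleton p) = addSingleton (permute g p) := by
  rw [permute_eq_iff]
  intro x y
  refine Fin.cases ?_ (fun a => ?_) x
  · rw [extendPerm_zero, addSingleton_zero, addSingleton_zero]
    refine Fin.cases ?_ (fun b => ?_) y
    · simp [extendPerm_zero]
    · simp [extendPerm_succ, Fin.succ_ne_zero]
  · refine Fin.cases ?_ (fun b => ?_) y
    · rw [extendPerm_zero, extendPerm_succ, Setoid.comm' (addSingleton _), addSingleton_zero,
        Setoid.comm' (addSingleton _), addSingleton_zero]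
      simp [Fin.succ_ne_zero]
    · rw [extendPerm_succ, extendPerm_succ, addSingleton_succ_succ, addSingleton_succ_succ]
      exact (permute_eq_iff.1 rfl a b)

/-- Two singleton blocks are interchangeable; this makes the choice of free point irrelevant up to
orbits. -/
theorem permute_swap_eq_self {p : Setoid (Fin n)} {x y : Fin n} (hx : ∀ z, p x z → z = x)
    (hy : ∀ z, p y z → z = y) : permute (Equiv.swap x y) p = p := by
  have key : ∀ a b, p a b → p (Equiv.swap x y a) (Equiv.swap x y b) := by
    intro a b hab
    by_cases h : a = b
    · subst h; exact p.refl _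
    · have h1 : a ≠ x := by rintro rfl; exact h (hx b hab).symm
      have h2 : a ≠ y := by rintro rfl; exact h (hy b hab).symm
      have h3 : b ≠ x := by rintro rfl; exact h (hx a (p.symm hab))
      have h4 : b ≠ y := by rintro rfl; exact h (hy a (p.symm hab))
      rwa [Equiv.swap_apply_of_ne_of_ne h1 h2, Equiv.swap_apply_of_ne_of_ne h3 h4]
  rw [permute_eq_iff]
  intro a b
  refine ⟨fun h => ?_, key a b⟩
  have := key _ _ h
  rwa [Equiv.swap_apply_self, Equiv.swap_apply_self] at this

end Singletons

/-! ### Orbits of pairs (subset, chain) and their stability in `n`. -/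

section Configurations

variable {n k i j : ℕ} {S : Finset ℕ}

instance rankSelectedChainAction (n : ℕ) (S : Finset ℕ) (j : ℕ) :
    MulAction (Equiv.Perm (Fin n)) (Fin j ↪o RankSelected n S) :=
  MulAction.compHom _ (rankSelectedAction n S)

theorem coe_smul_chain (g : Equiv.Perm (Fin n)) (c : Fin j ↪o RankSelected n S) (l : Fin j) :
    ((g • c) l).1 = permute g (c l).1 := rfl

theorem face_smul (l : Fin (j + 1)) (g : Equiv.Perm (Fin n))
    (c : Fin (j + 1) ↪o RankSelected n S) : face l (g • c) = g • face l c := rfl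

/-- A point that is in no element of a subset and in a singleton block of every partition of a
chain. -/
def IsFree (A : SubsetsOfCard n k i) (c : Fin j ↪o RankSelected n S) (x : Fin n) : Prop :=
  x ∉ A.1 ∧ ∀ l y, (c l).1 x y → y = x

theorem IsFree.smul {A : SubsetsOfCard n k i} {c : Fin j ↪o RankSelected n S} {x : Fin n}
    (h : IsFree A c x) (g : Equiv.Perm (Fin n)) : IsFree (g • A) (g • c) (g x) := by
  refine ⟨?_, fun l y hy => ?_⟩
  · rw [coe_smul_subset, Finset.mem_map_equiv, Equiv.symm_apply_apply]
    exact h.1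
  · rw [coe_smul_chain, permute_rel, Equiv.Perm.inv_def, Equiv.symm_apply_apply] at hy
    rw [← h.2 l _ hy, Equiv.apply_symm_apply]

theorem swap_smul_subset {A : SubsetsOfCard n k i} {c : Fin j ↪o RankSelected n S} {x y : Fin n}
    (hx : IsFree A c x) (hy : IsFree A c y) : Equiv.swap x y • A = A := by
  refine Subtype.ext (Finset.ext fun z => ?_)
  rw [coe_smul_subset, Finset.mem_map_equiv, Equiv.symm_swap]
  by_cases h1 : z = x
  · subst h1; simp [hx.1, hy.1]
  · by_cases h2 : z = y
    · subst h2; simp [hx.1, hy.1]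
    · rw [Equiv.swap_apply_of_ne_of_ne h1 h2]

theorem swap_smul_chain {A : SubsetsOfCard n k i} {c : Fin j ↪o RankSelected n S} {x y : Fin n}
    (hx : IsFree A c x) (hy : IsFree A c y) : Equiv.swap x y • c = c := by
  refine RelEmbedding.ext fun l => Subtype.ext ?_
  rw [coe_smul_chain]
  exact permute_swap_eq_self (hx.2 l) (hy.2 l)

/-- The largest partition `p` of the chain has rank at most `m`, and its singleton blocks are
singletons in the whole chain. If no point were free, the at least `n - k > 2 * m` points outside
`A` would all lie in non-singleton blocks of `p`. -/
theorem exists_isFree {m : ℕ} (hm : ∀ s ∈ S, s ≤ m) (hn : 2 * m + k < n) (A : SubsetsOfCard n k i)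
    (c : Fin j ↪o RankSelected n S) : ∃ x, IsFree A c x := by
  classical
  by_contra! hne
  have hA : A.1.card ≤ k := by have := A.2; omega
  obtain ⟨x, hx⟩ : ∃ x, x ∉ A.1 := by
    by_contra! h
    have := Finset.card_le_card fun x (_ : x ∈ Finset.univ) => h x
    rw [Finset.card_univ, Fintype.card_fin] at this
    omega
  obtain ⟨p, hp, hcp⟩ : ∃ p : Setoid (Fin n), rank p ≤ m ∧ ∀ l, (c l).1 ≤ p := by
    cases j with
    -- The empty chain has no largest member, but then any point outside `A` is free.
    | zero => exact absurd ⟨hx, fun l => l.elim0⟩ (hne x)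
    | succ j =>
      exact ⟨(c (Fin.last j)).1, hm _ (c (Fin.last j)).2, fun l => c.monotone (Fin.le_last l)⟩
  have h1 := card_nonsingleton_le p A.1ᶜ fun x hx => by
    have := hne x
    simp only [IsFree, not_and, not_forall] at this
    obtain ⟨l, y, hy, hyx⟩ := this (Finset.mem_compl.1 hx)
    exact ⟨y, hcp l hy, hyx⟩
  rw [Finset.card_compl, Fintype.card_fin] at h1
  omega

/-- Adding a new point to the ground set, outside of a subset. -/
def addPointSubset (A : SubsetsOfCard n k i) : SubsetsOfCard (n + 1) k i :=
  ⟨A.1.map (Fin.succEmb n), by rw [Finset.card_map]; exact A.2⟩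

/-- Adding a new point to the ground set, as a singleton block of all partitions of a chain. -/
def addPointChain (c : Fin j ↪o RankSelected n S) : Fin j ↪o RankSelected (n + 1) S :=
  c.trans (addSingletonEmb n S)

theorem addPointSubset_smul (g : Equiv.Perm (Fin n)) (A : SubsetsOfCard n k i) :
    addPointSubset (g • A) = extendPerm g • addPointSubset A := by
  refine Subtype.ext ?_
  rw [coe_smul_subset]
  change (A.1.map _).map _ = (A.1.map _).map _
  rw [Finset.map_map, Finset.map_map]
  congr 1

theorem addPointChain_smul (g : Equiv.Perm (Fin n)) (c : Fin j ↪o RankSelected n S) :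
    addPointChain (g • c) = extendPerm g • addPointChain c :=
  RelEmbedding.ext fun l => Subtype.ext (permute_extendPerm g (c l).1).symm

theorem addPointSubset_injective :
    Function.Injective (addPointSubset : SubsetsOfCard n k i → SubsetsOfCard (n + 1) k i) :=
  fun _ _ h => Subtype.ext (Finset.map_injective _ (congrArg Subtype.val h))

theorem addPointChain_injective :
    Function.Injective
      (addPointChain : (Fin j ↪o RankSelected n S) → (Fin j ↪o RankSelected (n + 1) S)) :=
  fun _ _ h => RelEmbedding.ext fun l => (addSingletonEmb n S).injective (DFunLike.congr_fun h l)

theorem isFree_addPoint (A : SubsetsOfCard n k i) (c : Fin j ↪o RankSelected n S) :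
    IsFree (addPointSubset A) (addPointChain c) 0 := by
  refine ⟨?_, fun l y hy => addSingleton_zero.1 hy⟩
  intro h
  obtain ⟨x, -, hx⟩ := Finset.mem_map.1 h
  exact Fin.succ_ne_zero x hx

theorem exists_addPoint_eq {A : SubsetsOfCard (n + 1) k i} {c : Fin j ↪o RankSelected (n + 1) S}
    (h : IsFree A c 0) :
    ∃ (A' : SubsetsOfCard n k i) (c' : Fin j ↪o RankSelected n S),
      addPointSubset A' = A ∧ addPointChain c' = c := by
  have hA : (A.1.preimage Fin.succ (Fin.succ_injective n).injOn).map (Fin.succEmb n) = A.1 := by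
    ext x
    simp only [Finset.mem_map, Finset.mem_preimage, Fin.coe_succEmb]
    constructor
    · rintro ⟨a, ha, rfl⟩
      exact ha
    · intro hx
      obtain ⟨a, rfl⟩ := Fin.exists_succ_eq.2 (show x ≠ 0 by rintro rfl; exact h.1 hx)
      exact ⟨a, hx, rfl⟩
  have hc : ∀ l, addSingleton ((c l).1.comap Fin.succ) = (c l).1 := fun l =>
    addSingleton_comap fun y hy => h.2 l y hy
  refine ⟨⟨A.1.preimage Fin.succ (Fin.succ_injective n).injOn, ?_⟩,
    OrderEmbedding.ofMapLEIff (fun l => ⟨(c l).1.comap Fin.succ, ?_⟩) fun l l' => ?_,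
    Subtype.ext hA, RelEmbedding.ext fun l => Subtype.ext (hc l)⟩
  · rw [← Finset.card_map (Fin.succEmb n), hA]
    exact A.2
  · rw [← rank_addSingleton, hc]
    exact (c l).2
  · rw [← c.le_iff_le, ← Subtype.coe_le_coe, ← Subtype.coe_le_coe, ← addSingleton_le, hc, hc]

/-- Orbits of pairs of a subset and a chain of set partitions. -/
abbrev ConfigOrbits (n k i j : ℕ) (S : Finset ℕ) : Type :=
  MulAction.orbitRel.Quotient (Equiv.Perm (Fin n))
    (SubsetsOfCard n k i × (Fin j ↪o RankSelected n S))

/-- Adding a new point, on orbits. -/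
def addPointOrbit (n k i j : ℕ) (S : Finset ℕ) :
    ConfigOrbits n k i j S → ConfigOrbits (n + 1) k i j S :=
  Quotient.map (fun w => (addPointSubset w.1, addPointChain w.2)) (by
    rintro ⟨x, y⟩ ⟨x', y'⟩ ⟨g, hg⟩
    obtain ⟨rfl, rfl⟩ := Prod.ext_iff.1 hg
    exact ⟨extendPerm g, Prod.ext (addPointSubset_smul g x').symm (addPointChain_smul g y').symm⟩)

theorem addPointOrbit_mk (A : SubsetsOfCard n k i) (c : Fin j ↪o RankSelected n S) :
    addPointOrbit n k i j S (orbitMk _ A c) = orbitMk _ (addPointSubset A) (addPointChain c) := rfl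

/-- If `g` carries one enlarged pair to another, then `0` and `g 0` are both free in the target, so
their transposition fixes the target. Composing with it yields a permutation that fixes `0`, hence
one that comes from `Fin n`. -/
theorem addPointOrbit_injective : Function.Injective (addPointOrbit n k i j S) := by
  intro q q'
  obtain ⟨⟨A, c⟩, rfl⟩ := Quotient.exists_rep q
  obtain ⟨⟨A', c'⟩, rfl⟩ := Quotient.exists_rep q'
  intro h
  change orbitMk _ (addPointSubset A) (addPointChain c) =
    orbitMk _ (addPointSubset A') (addPointChain c') at h
  change orbitMk _ A c = orbitMk _ A' c'
  obtain ⟨g, h1, h2⟩ := orbitMk_eq_iff.1 h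
  have hfree := (isFree_addPoint A' c').smul g
  rw [h1, h2] at hfree
  have hfree' := isFree_addPoint A c
  obtain ⟨g', hg'⟩ := exists_eq_extendPerm (h := Equiv.swap (g 0) 0 * g) (by simp)
  refine orbitMk_eq_iff.2 ⟨g', ?_, ?_⟩
  · apply addPointSubset_injective
    rw [addPointSubset_smul, ← hg', mul_smul, h1, swap_smul_subset hfree hfree']
  · apply addPointChain_injective
    rw [addPointChain_smul, ← hg', mul_smul, h2, swap_smul_chain hfree hfree']

/-- A free point exists, and a transposition moves it to `0`, where it can be removed. -/
theorem addPointOrbit_surjective {m : ℕ} (hm : ∀ s ∈ S, s ≤ m) (hn : 2 * m + k ≤ n) :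
    Function.Surjective (addPointOrbit n k i j S) := by
  intro q
  obtain ⟨⟨A, c⟩, rfl⟩ := Quotient.exists_rep q
  obtain ⟨x, hx⟩ := exists_isFree hm (by omega : 2 * m + k < n + 1) A c
  have hfree := hx.smul (Equiv.swap x 0)
  rw [Equiv.swap_apply_left] at hfree
  obtain ⟨A', c', h1, h2⟩ := exists_addPoint_eq hfree
  refine ⟨orbitMk _ A' c', ?_⟩
  rw [addPointOrbit_mk, h1, h2]
  exact orbitMk_smul _ A c

/-- The dimension of the kernel of the map that is induced on orbits by an alternating or weighted
sum of the face maps. -/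
def orbitKernelDim (S : Finset ℕ) (k i j : ℕ) (ε : Fin (j + 1) → ℂ) (n : ℕ) : ℕ :=
  Module.finrank ℂ (LinearMap.ker (faceSum (orbitFace (Equiv.Perm (Fin n)) (SubsetsOfCard n k i)
    (face (P := RankSelected n S) (j := j)) face_smul) ε))

theorem orbitKernelDim_succ {m : ℕ} (hm : ∀ s ∈ S, s ≤ m) (ε : Fin (j + 1) → ℂ)
    (hn : 2 * m + k ≤ n) : orbitKernelDim S k i j ε n = orbitKernelDim S k i j ε (n + 1) := by
  refine finrank_ker_faceSum_congr
    (Equiv.ofBijective (addPointOrbit n k i (j + 1) S)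
      ⟨addPointOrbit_injective, addPointOrbit_surjective hm hn⟩)
    (addPointOrbit_injective (n := n) (k := k) (i := i) (j := j) (S := S)) ?_ ε
  intro l q
  obtain ⟨⟨A, c⟩, rfl⟩ := Quotient.exists_rep q
  rfl

theorem orbitKernelDim_eq {m : ℕ} (hm : ∀ s ∈ S, s ≤ m) (ε : Fin (j + 1) → ℂ) {N : ℕ}
    (hN : 2 * m + k ≤ N) (hn : N ≤ n) :
    orbitKernelDim S k i j ε n = orbitKernelDim S k i j ε N := by
  induction n, hn using Nat.le_induction with
  | base => rfl
  | succ n hn ih => rw [← ih, orbitKernelDim_succ hm ε (hN.trans hn)]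

end Configurations

section Finiteness

instance finite_setoid (n : ℕ) : Finite (Setoid (Fin n)) :=
  Finite.of_injective (fun (p : Setoid (Fin n)) (x y : Fin n) => p x y) fun _ _ h =>
    Setoid.ext fun x y => iff_of_eq (congrFun (congrFun h x) y)

instance finite_chain (n : ℕ) (S : Finset ℕ) (j : ℕ) : Finite (Fin j ↪o RankSelected n S) :=
  DFunLike.finite _

instance finite_flag (n : ℕ) (S : Finset ℕ) : Finite (Flag (RankSelected n S)) :=
  Finite.of_injective (fun F => (F : Set (RankSelected n S))) SetLike.coe_injective

end Finiteness

/-! ### The rank function and the maximal chains of rank-selected subposets. -/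

section Grading

variable {n : ℕ}

theorem rank_lt_rank {p q : Setoid (Fin n)} (h : p < q) : rank p < rank q := by
  classical
  have hlt : Nat.card (Quotient q) < Nat.card (Quotient p) := by
    rw [Nat.card_eq_fintype_card, Nat.card_eq_fintype_card]
    refine Fintype.card_lt_of_surjective_not_injective
      (Quotient.map id fun _ _ hab => h.le hab : Quotient p → Quotient q) ?_ ?_
    · intro b
      obtain ⟨x, rfl⟩ := Quotient.exists_rep b
      exact ⟨Quotient.mk _ x, rfl⟩
    · intro hinj
      refine h.not_ge fun x y hxy => ?_
      exact Quotient.exact (hinj (a₁ := Quotient.mk _ x) (a₂ := Quotient.mk _ y)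
        (Quotient.sound hxy))
  -- This keeps the truncated subtraction in `rank` from collapsing the strict inequality.
  have hle : Nat.card (Quotient p) ≤ n := by
    have := Nat.card_le_card_of_surjective _ (Quotient.mk_surjective (s := p))
    rwa [Nat.card_eq_fintype_card (α := Fin n), Fintype.card_fin] at this
  rw [rank, rank]
  omega

theorem rank_le_rank {p q : Setoid (Fin n)} (h : p ≤ q) : rank p ≤ rank q := by
  rcases h.eq_or_lt with rfl | h
  · exact le_rfl
  · exact (rank_lt_rank h).le

theorem rank_bot : rank (⊥ : Setoid (Fin n)) = 0 := by
  have : Nat.card (Fin n) ≤ Nat.card (Quotient (⊥ : Setoid (Fin n))) :=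
    Nat.card_le_card_of_injective (Quotient.mk ⊥) fun x y h => Quotient.exact h
  rw [Nat.card_eq_fintype_card (α := Fin n), Fintype.card_fin] at this
  rw [rank]
  omega

theorem le_rank_top : n ≤ rank (⊤ : Setoid (Fin n)) + 1 := by
  have : Nat.card (Quotient (⊤ : Setoid (Fin n))) ≤ 1 :=
    Finite.card_le_one_iff_subsingleton.2 ⟨fun a b =>
      Quotient.inductionOn₂ a b fun _ _ => Quotient.sound trivial⟩
  rw [rank]
  omega

/-- Merging two blocks raises the rank by one. -/
theorem exists_rank_succ {p q : Setoid (Fin n)} (h : p < q) :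
    ∃ r, p ≤ r ∧ r ≤ q ∧ rank r = rank p + 1 := by
  classical
  obtain ⟨x, y, hxy, hne⟩ : ∃ x y, q x y ∧ ¬ p x y := by
    by_contra! hne
    exact h.not_ge fun x y hxy => hne x y hxy
  -- Points of the block of `y` are sent to the block of `x`, so the range misses exactly one block
  -- of `p`.
  let f : Fin n → Quotient p := fun a =>
    if (Quotient.mk p a) = Quotient.mk p y then Quotient.mk p x else Quotient.mk p a
  have hf : ∀ a c, f a = Quotient.mk p c → q a c := by
    intro a c hac
    simp only [f] at hac
    split_ifs at hac with hay
    · exact q.trans (h.le (Quotient.exact hay)) (q.trans (q.symm hxy) (h.le (Quotient.exact hac)))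
    · exact h.le (Quotient.exact hac)
  have hne' : Quotient.mk p x ≠ Quotient.mk p y := fun h => hne (Quotient.exact h)
  refine ⟨Setoid.ker f, fun a b hab => ?_, fun a b hab => ?_, ?_⟩
  · have : Quotient.mk p a = Quotient.mk p b := Quotient.sound hab
    change f a = f b
    simp only [f, this]
  · obtain ⟨c, hc⟩ := Quotient.exists_rep (f b)
    have hab' : f a = f b := hab
    exact q.trans (hf a c (hab'.trans hc.symm)) (q.symm (hf b c hc.symm))
  · have hrange : Set.range f = {Quotient.mk p y}ᶜ := by
      ext b
      rw [Set.mem_compl_iff, Set.mem_singleton_iff]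
      constructor
      · rintro ⟨a, rfl⟩
        simp only [f]
        split_ifs with hay
        · exact hne'
        · exact hay
      · intro hb
        obtain ⟨a, rfl⟩ := Quotient.exists_rep b
        exact ⟨a, if_neg hb⟩
    have hcard : Nat.card (Quotient (Setoid.ker f)) = Nat.card (Quotient p) - 1 := by
      rw [Nat.card_congr (Setoid.quotientKerEquivRange f), hrange, Nat.card_coe_set_eq,
        Set.ncard_compl, Set.ncard_singleton]
    have h2 : Nat.card (Quotient p) ≤ n := by
      have := Nat.card_le_card_of_surjective _ (Quotient.mk_surjective (s := p))
      rwa [Nat.card_eq_fintype_card (α := Fin n), Fintype.card_fin] at this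
    have h1 : 0 < Nat.card (Quotient p) := Nat.card_pos_iff.2 ⟨⟨Quotient.mk p x⟩, inferInstance⟩
    rw [rank, rank, hcard]
    omega

theorem exists_rank_eq {p q : Setoid (Fin n)} (h : p ≤ q) {s : ℕ} (hp : rank p ≤ s)
    (hq : s ≤ rank q) : ∃ r, p ≤ r ∧ r ≤ q ∧ rank r = s := by
  induction s, hp using Nat.le_induction with
  | base => exact ⟨p, le_rfl, h, rfl⟩
  | succ s hs ih =>
    obtain ⟨r, h1, h2, h3⟩ := ih (by omega)
    have hlt : r < q := h2.lt_of_ne (by rintro rfl; omega)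
    obtain ⟨t, h4, h5, h6⟩ := exists_rank_succ hlt
    exact ⟨t, h1.trans h4, h5, by omega⟩

variable {S : Finset ℕ} {j : ℕ}

theorem RankSelected.eq_of_rank_eq {p q : RankSelected n S} (h : p ≤ q ∨ q ≤ p)
    (hr : rank p.1 = rank q.1) : p = q := by
  rcases h with h | h
  · rcases h.eq_or_lt with h | h
    · exact h
    · exact absurd (rank_lt_rank (Subtype.coe_lt_coe.2 h)) (by omega)
  · rcases h.eq_or_lt with h | h
    · exact h.symm
    · exact absurd (rank_lt_rank (Subtype.coe_lt_coe.2 h)) (by omega)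

theorem injective_rank_chain (c : Fin j ↪o RankSelected n S) :
    Function.Injective fun l => (⟨rank (c l).1, (c l).2⟩ : S) := fun l l' h =>
  c.injective (RankSelected.eq_of_rank_eq
    ((le_total l l').imp (fun h => c.monotone h) fun h => c.monotone h) (congrArg Subtype.val h))

theorem isEmpty_chain (h : S.card < j) : IsEmpty (Fin j ↪o RankSelected n S) := by
  refine ⟨fun c => ?_⟩
  have := Fintype.card_le_of_injective _ (injective_rank_chain c)
  rw [Fintype.card_fin, Fintype.card_coe] at this
  omega

theorem exists_rank_chain_eq (hj : S.card = j) (c : Fin j ↪o RankSelected n S) {s : ℕ}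
    (hs : s ∈ S) : ∃ l, rank (c l).1 = s := by
  have hb := (Fintype.bijective_iff_injective_and_card _).2
    ⟨injective_rank_chain c, by rw [Fintype.card_fin, Fintype.card_coe, hj]⟩
  obtain ⟨l, hl⟩ := hb.2 ⟨s, hs⟩
  exact ⟨l, congrArg Subtype.val hl⟩

/-- A chain that meets all ranks, as a maximal chain. -/
def chainFlag (hj : S.card = j) (c : Fin j ↪o RankSelected n S) : Flag (RankSelected n S) where
  carrier := Set.range c
  Chain' := by
    rintro _ ⟨l, rfl⟩ _ ⟨l', rfl⟩ -
    exact (le_total l l').imp (fun h => c.monotone h) fun h => c.monotone h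
  max_chain' := by
    intro s hs hcs
    refine hcs.antisymm fun p hp => ?_
    obtain ⟨l, hl⟩ := exists_rank_chain_eq hj c p.2
    exact ⟨l, RankSelected.eq_of_rank_eq (hs.total (hcs ⟨l, rfl⟩) hp) hl⟩

theorem coe_chainFlag (hj : S.card = j) (c : Fin j ↪o RankSelected n S) :
    (chainFlag hj c : Set (RankSelected n S)) = Set.range c := rfl

theorem chainFlag_injective (hj : S.card = j) :
    Function.Injective (chainFlag (n := n) hj) := fun _ _ h =>
  OrderEmbedding.range_inj.1 (congrArg (fun F : Flag _ => (F : Set (RankSelected n S))) h)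

/-- If rank `s` were missing, a partition of rank `s` could be inserted between the highest member
below and the lowest member above, contradicting maximality. When there is no such member, `⊥` or
`⊤` takes its place; `s < n` guarantees that `⊤` has rank at least `s`. -/
theorem exists_mem_flag (hn : ∀ s ∈ S, s < n) (F : Flag (RankSelected n S)) {s : ℕ} (hs : s ∈ S) :
    ∃ p ∈ F, rank p.1 = s := by
  by_contra! hne
  have htot : ∀ p ∈ F, ∀ q ∈ F, p ≤ q ∨ q ≤ p := fun p hp q hq => F.Chain'.total hp hq
  have hle : ∀ p ∈ F, ∀ q ∈ F, rank p.1 ≤ rank q.1 → p.1 ≤ q.1 := by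
    intro p hp q hq h
    rcases htot p hp q hq with hpq | hpq
    · exact hpq
    · have := rank_le_rank (show q.1 ≤ p.1 from hpq)
      rw [RankSelected.eq_of_rank_eq (Or.inr hpq) (by omega)]
  obtain ⟨q₀, hq₀, hUq₀, hq₀'⟩ : ∃ q₀ : Setoid (Fin n), s ≤ rank q₀ ∧
      (∀ q ∈ F, s < rank q.1 → q₀ ≤ q.1) ∧ ∀ p ∈ F, rank p.1 < s → p.1 ≤ q₀ := by
    by_cases hU : {q | q ∈ F ∧ s < rank q.1}.Nonempty
    · obtain ⟨q₀, hq₀, hmin⟩ := Set.Finite.exists_minimalFor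
        (fun q : RankSelected n S => rank q.1) _ (Set.toFinite {q | q ∈ F ∧ s < rank q.1}) hU
      refine ⟨q₀.1, hq₀.2.le, fun q hq hsq => hle _ hq₀.1 _ hq ?_,
        fun p hp hps => hle _ hp _ hq₀.1 (hps.trans hq₀.2).le⟩
      by_contra! h
      exact absurd (hmin ⟨hq, hsq⟩ h.le) (by simpa using h)
    · refine ⟨⊤, ?_, fun q hq hsq => absurd ⟨q, hq, hsq⟩ hU, fun _ _ _ => le_top⟩
      have := hn s hs
      have := le_rank_top (n := n)
      omega
  obtain ⟨p₀, hp₀, hLp₀, hpq⟩ : ∃ p₀ : Setoid (Fin n), rank p₀ ≤ s ∧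
      (∀ p ∈ F, rank p.1 < s → p.1 ≤ p₀) ∧ p₀ ≤ q₀ := by
    by_cases hL : {p | p ∈ F ∧ rank p.1 < s}.Nonempty
    · obtain ⟨p₀, hp₀, hmax⟩ := Set.Finite.exists_maximalFor
        (fun q : RankSelected n S => rank q.1) _ (Set.toFinite {p | p ∈ F ∧ rank p.1 < s}) hL
      refine ⟨p₀.1, hp₀.2.le, fun p hp hsp => hle _ hp _ hp₀.1 ?_, hq₀' _ hp₀.1 hp₀.2⟩
      by_contra! h
      exact absurd (hmax ⟨hp, hsp⟩ h.le) (by simpa using h)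
    · exact ⟨⊥, by rw [rank_bot]; omega, fun p hp hsp => absurd ⟨p, hp, hsp⟩ hL, bot_le⟩
  obtain ⟨r, hr1, hr2, hr3⟩ := exists_rank_eq hpq hp₀ hq₀
  let r' : RankSelected n S := ⟨r, by rw [hr3]; exact hs⟩
  have hcomp : ∀ p ∈ F, r' ≤ p ∨ p ≤ r' := by
    intro p hp
    rcases lt_trichotomy (rank p.1) s with h | h | h
    · exact Or.inr ((hLp₀ p hp h).trans hr1)
    · exact absurd h (hne p hp)
    · exact Or.inl (hr2.trans (hUq₀ p hp h))
  have hchain : IsChain (· ≤ ·) (insert r' (F : Set (RankSelected n S))) :=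
    F.Chain'.insert fun p hp _ => hcomp p hp
  have : r' ∈ F := by
    have h := F.max_chain' hchain (Set.subset_insert _ _)
    change r' ∈ F.carrier
    rw [h]
    exact Set.mem_insert _ _
  exact hne r' this hr3

theorem chainFlag_surjective (hj : S.card = j) (hn : ∀ s ∈ S, s < n) :
    Function.Surjective (chainFlag (n := n) hj) := by
  intro F
  choose f hfF hfr using fun s : S => exists_mem_flag hn F s.2
  let e := S.orderIsoOfFin hj
  have hmono : StrictMono fun l => f (e l) := by
    intro l l' hl
    have hrk : rank (f (e l)).1 < rank (f (e l')).1 := by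
      rw [hfr, hfr]
      exact e.strictMono hl
    rcases F.Chain'.total (hfF (e l)) (hfF (e l')) with h | h
    · exact h.lt_of_ne (by rintro h'; rw [h'] at hrk; omega)
    · have := rank_le_rank (show (f (e l')).1 ≤ (f (e l)).1 from h)
      omega
  refine ⟨OrderEmbedding.ofStrictMono _ hmono, ?_⟩
  -- The chosen members, one of each rank, already form a maximal chain inside `F`, so they exhaust
  -- `F`.
  refine SetLike.coe_injective ((chainFlag hj _).max_chain' F.Chain' ?_)
  rintro _ ⟨l, rfl⟩
  exact hfF (e l)

/-- The maximal chains of a rank-selected subposet are the chains that meet all ranks. -/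
def chainFlagEquiv (hj : S.card = j) (hn : ∀ s ∈ S, s < n) :
    (Fin j ↪o RankSelected n S) ≃ Flag (RankSelected n S) :=
  Equiv.ofBijective _ ⟨chainFlag_injective hj, chainFlag_surjective hj hn⟩

theorem chainFlag_smul (hj : S.card = j) (g : Equiv.Perm (Fin n))
    (c : Fin j ↪o RankSelected n S) :
    chainFlag hj (g • c) = rankSelectedAction n S g • chainFlag hj c := by
  apply SetLike.coe_injective
  rw [Flag.coe_smul, coe_chainFlag, coe_chainFlag]
  exact Set.range_comp (rankSelectedAction n S g) c

end Grading

/-! ### The multiplicities of subset modules in `α_S(n)` and `β_S(n)`. -/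

section Multiplicities

variable {n k i j : ℕ} {S : Finset ℕ}

/-- With zero weights the kernel is the whole space, so the right-hand side counts orbits of pairs
(subset, maximal chain). -/
theorem multiplicity_alpha (hj : S.card = j + 1) (hn : ∀ s ∈ S, s < n) :
    multiplicity (Representation.ofMulAction ℂ (Equiv.Perm (Fin n)) (SubsetsOfCard n k i))
      (alpha n S) = orbitKernelDim S k i j 0 n := by
  have := Fintype.ofFinite (Fin (j + 1) ↪o RankSelected n S)
  have := Fintype.ofFinite (Fin j ↪o RankSelected n S)
  let e := (chainFlagEquiv (n := n) hj hn).symm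
  have he : ∀ (g : Equiv.Perm (Fin n)) F, e (rankSelectedAction n S g • F) = g • e F := by
    intro g F
    obtain ⟨c, rfl⟩ := (chainFlagEquiv (n := n) hj hn).surjective F
    rw [Equiv.symm_apply_apply, Equiv.symm_apply_eq]
    exact (chainFlag_smul hj g c).symm
  let a : Representation.IntertwiningMap (alpha n S)
      (Representation.ofMulAction ℂ (Equiv.Perm (Fin n)) (Fin (j + 1) ↪o RankSelected n S)) :=
    LinearMap.intertwiningMap_of_isIntertwiningMap _ _
      (MonoidAlgebra.mapDomainLinearEquiv ℂ ℂ e).toLinearMap fun g v => by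
        suffices h : (MonoidAlgebra.mapDomainLinearEquiv ℂ ℂ e).toLinearMap ∘ₗ alpha n S g =
            Representation.ofMulAction ℂ (Equiv.Perm (Fin n)) (Fin (j + 1) ↪o RankSelected n S) g ∘ₗ
              (MonoidAlgebra.mapDomainLinearEquiv ℂ ℂ e).toLinearMap from LinearMap.congr_fun h v
        ext F : 2
        simp only [LinearMap.comp_apply, MonoidAlgebra.lsingle_apply, LinearEquiv.coe_coe,
          MonoidAlgebra.mapDomainLinearEquiv_single, Representation.ofMulAction_single, alpha,
          MonoidHom.comp_apply, he]
  refine multiplicity_ofMulAction face_smul 0 (alpha n S) a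
    (MonoidAlgebra.mapDomainLinearEquiv ℂ ℂ e).injective fun v => ⟨fun _ => ?_, fun _ => ?_⟩
  · obtain ⟨w, hw⟩ := (MonoidAlgebra.mapDomainLinearEquiv ℂ ℂ e).surjective
      (MonoidAlgebra.ofCoeff v)
    exact ⟨w, congrArg MonoidAlgebra.coeff hw⟩
  · simp [faceSum]

theorem coeff_boundary {P : Type} [PartialOrder P] (v : ℂ[Fin (j + 1) ↪o P]) :
    (boundary P j v).coeff = faceSum face (fun l : Fin (j + 1) => (-1 : ℂ) ^ (l : ℕ)) v.coeff := by
  suffices h : (MonoidAlgebra.coeffLinearEquiv ℂ).toLinearMap ∘ₗ boundary P j =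
      faceSum face (fun l : Fin (j + 1) => (-1 : ℂ) ^ (l : ℕ)) ∘ₗ
        (MonoidAlgebra.coeffLinearEquiv ℂ).toLinearMap from LinearMap.congr_fun h v
  ext c : 3
  simp [boundary_single, faceSum]

/-- Members of a chain have distinct ranks in `S`, so there are no chains with `j + 2` elements. The
boundaries vanish, and homology is the kernel of the boundary map. -/
theorem multiplicity_homologyRep (hj : S.card < j + 2) :
    multiplicity (Representation.ofMulAction ℂ (Equiv.Perm (Fin n)) (SubsetsOfCard n k i))
      ((homologyRep (RankSelected n S) (j + 1)).comp (rankSelectedAction n S)) =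
    orbitKernelDim S k i j (fun l => (-1 : ℂ) ^ (l : ℕ)) n := by
  have := Fintype.ofFinite (Fin (j + 1) ↪o RankSelected n S)
  have := Fintype.ofFinite (Fin j ↪o RankSelected n S)
  have hempty : IsEmpty (Fin (j + 2) ↪o RankSelected n S) := isEmpty_chain hj
  have hbot : boundaries (RankSelected n S) (j + 1) = ⊥ := by
    rw [eq_bot_iff]
    rintro v ⟨w, hw⟩
    have hw0 : w = 0 := MonoidAlgebra.ext (Finsupp.ext fun c => hempty.elim c)
    rw [hw0, map_zero] at hw
    exact Subtype.ext hw.symm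
  let f : ReducedHomology (RankSelected n S) (j + 1) →ₗ[ℂ] ℂ[Fin (j + 1) ↪o RankSelected n S] :=
    (boundaries (RankSelected n S) (j + 1)).liftQ (cycles (RankSelected n S) (j + 1)).subtype
      (by rw [hbot]; exact bot_le)
  have hf : ∀ v, f (Submodule.Quotient.mk v) = v.1 := fun v => rfl
  let a : Representation.IntertwiningMap
      ((homologyRep (RankSelected n S) (j + 1)).comp (rankSelectedAction n S))
      (Representation.ofMulAction ℂ (Equiv.Perm (Fin n)) (Fin (j + 1) ↪o RankSelected n S)) :=
    LinearMap.intertwiningMap_of_isIntertwiningMap _ _ f fun g v => by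
      obtain ⟨v, rfl⟩ := Submodule.Quotient.mk_surjective _ v
      rfl
  refine multiplicity_ofMulAction face_smul _ _ a ?_ fun v => ?_
  · rw [injective_iff_map_eq_zero]
    intro v hv
    obtain ⟨v, rfl⟩ := Submodule.Quotient.mk_surjective _ v
    have : v = 0 := Subtype.ext hv
    rw [this]
    rfl
  · have hv := coeff_boundary (MonoidAlgebra.ofCoeff v)
    rw [MonoidAlgebra.coeff_ofCoeff] at hv
    rw [← hv, MonoidAlgebra.coeff_eq_zero]
    constructor
    · intro h
      exact ⟨Submodule.Quotient.mk ⟨MonoidAlgebra.ofCoeff v, h⟩, rfl⟩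
    · rintro ⟨w, hw⟩
      obtain ⟨w, rfl⟩ := Submodule.Quotient.mk_surjective _ w
      have : w.1 = MonoidAlgebra.ofCoeff v := MonoidAlgebra.ext hw
      rw [← this]
      exact w.2

theorem multiplicity_beta (hj : S.card = j + 1) :
    multiplicity (Representation.ofMulAction ℂ (Equiv.Perm (Fin n)) (SubsetsOfCard n k i))
      (beta n S) = orbitKernelDim S k i j (fun l => (-1 : ℂ) ^ (l : ℕ)) n := by
  rw [← multiplicity_homologyRep (by omega), beta, hj]

end Multiplicities

end PartitionStability

end

theorem corollary5p6 (S : Finset ℕ) (hS : S.Nonempty) (hpos : ∀ s ∈ S, 1 ≤ s) (k : ℕ) :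
    ∃ a b : ℕ, ∀ n : ℕ, 2 * S.max' hS + k ≤ n → ∀ hk : k ≤ n - k,
      PartitionStability.multiplicity
          (PartitionStability.spechtRep (PartitionStability.twoRow (n - k) k hk) n)
          (PartitionStability.alpha n S) = a ∧
      PartitionStability.multiplicity
          (PartitionStability.spechtRep (PartitionStability.twoRow (n - k) k hk) n)
          (PartitionStability.beta n S) = b := by
  open PartitionStability in
  obtain ⟨j, hj⟩ : ∃ j, S.card = j + 1 := Nat.exists_eq_succ_of_ne_zero hS.card_pos.ne'
  have hm : ∀ s ∈ S, s ≤ S.max' hS := fun s hs => S.le_max' s hs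
  have hm1 : 1 ≤ S.max' hS := hpos _ (S.max'_mem hS)
  -- The stable dimension, read off at the first `n` of the stable range; `i = 0` and `i = 1` stand
  -- for `k`-subsets and `(k-1)`-subsets.
  let dim (i : ℕ) (ε : Fin (j + 1) → ℂ) : ℕ := orbitKernelDim S k i j ε (2 * S.max' hS + k)
  refine ⟨dim 0 0 - dim 1 0, dim 0 (fun l => (-1) ^ (l : ℕ)) - dim 1 (fun l => (-1) ^ (l : ℕ)),
    fun n hn hk => ?_⟩
  have : FiniteDimensional ℂ (ReducedHomology (RankSelected n S) S.card) :=
    Module.Finite.quotient ℂ _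
  have hα := multiplicity_spechtRep hk (alpha n S)
  have hβ := multiplicity_spechtRep hk (beta n S)
  -- Since `max(S) ≥ 1`, the bound `2 max(S) + k ≤ n` gives `s < n` for all `s ∈ S`, as the
  -- description of maximal chains needs.
  rw [multiplicity_alpha hj fun s hs => by have := hm s hs; omega,
    multiplicity_alpha hj fun s hs => by have := hm s hs; omega,
    orbitKernelDim_eq hm _ le_rfl hn, orbitKernelDim_eq hm _ le_rfl hn] at hα
  rw [multiplicity_beta hj, multiplicity_beta hj, orbitKernelDim_eq hm _ le_rfl hn,
    orbitKernelDim_eq hm _ le_rfl hn] at hβ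
  exact ⟨Nat.eq_sub_of_add_eq hα, Nat.eq_sub_of_add_eq hβ⟩
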